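/- **Theorem 1.7.** Let $G$ be a (discrete) group. (1) Let $W$ be an L-embedded Banach space over $\mathbb R$ or $\mathbb C$, that is, $W^{**}=W\oplus_1 W_0$ for some subspace $W_0\subset W^{**}$: every element of $W^{**}$ is uniquely $w+z$ with $w\in W$ (canonically embedded), $z\in W_0$, and $\|w+z\|=\|w\|+\|z\|$. Let $G$ act on $W$ by linear isometries, let $\delta>0$, and let $\alpha\in W$ satisfy $\|\alpha\|=1$ and $\|g\alpha-\alpha\|\le\frac{\delta}{10}$ for all $g\in G$. Then there is a $G$-invariant $\beta\in W$ with $\|\alpha-\beta\|\le\delta$. (2) Consequently, let $V$ be a real or complex Banach space whose dual $V^*$ is L-embedded, on which $G$ acts by linear isometries, and let $G$ act on $V^*$ by the dual action $(g\alpha)(v)=\alpha(g^{-1}v)$. If $\delta>0$ and $\alpha\in V^*$ satisfies $\|\alpha\|=1$ and $\|g\alpha-\alpha\|\le\frac{\delta}{10}$ for all $g\in G$, then there is a $G$-invariant $\beta\in V^*$ with $\|\alpha-\beta\|\le\delta$. (3) In particular, for every compact Hausdorff space $X$, with $C(X)$ the Banach space of continuous complex-valued functions on $X$, the conclusion of (1)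 holds for $W=C(X)^*$, and the conclusion of (2) holds for $V=C(X)$. (4) In particular, for every von Neumann algebra $M$ on a complex Hilbert space $H$, the conclusion of (1) holds for the predual $W=M_*$, the norm-closed linear span in $M^*$ of the vector functionals $x\mapsto\langle \xi, x\eta\rangle$, $\xi,\eta\in H$ (with the inner product linear in the second variable). -/

import Mathlib

noncomputable section

/-- A normed space `W` (in the theorem: a Banach space) is *L-embedded* if its bidual is the
`ℓ¹`-direct sum `W** = W ⊕₁ W₀` of (the canonical image of) `W` and some subspace `W₀` of `W**`. -/
def IsLEmbedded (𝕜 W : Type*) [RCLike 𝕜] [NormedAddCommGroup W] [NormedSpace 𝕜 W] : Prop :=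
  ∃ W₀ : Submodule 𝕜 (StrongDual 𝕜 (StrongDual 𝕜 W)),
    IsCompl (NormedSpace.inclusionInDoubleDual 𝕜 W).toLinearMap.range W₀ ∧
    ∀ w : W, ∀ z ∈ W₀, ‖NormedSpace.inclusionInDoubleDual 𝕜 W w + z‖ = ‖w‖ + ‖z‖

/-- The assertion of the question for the vectors of the space `W` itself: for every linear
isometric action `ρ` of the (discrete) group `G` on `W`, every unit vector all of whose translates
are within `δ / 10` of it is within `δ` of a `G`-invariant vector. -/
def AlmostInvariantNearInvariant (𝕜 W G : Type*) [RCLike 𝕜] [NormedAddCommGroup W]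
    [NormedSpace 𝕜 W] [Group G] : Prop :=
  ∀ (ρ : G →* (W ≃ₗᵢ[𝕜] W)) (δ : ℝ), 0 < δ → ∀ α : W, ‖α‖ = 1 →
    (∀ g : G, ‖ρ g α - α‖ ≤ δ / 10) →
      ∃ β : W, (∀ g : G, ρ g β = β) ∧ ‖α - β‖ ≤ δ

/-- The dual (contragredient) action on functionals: `(g α)(v) = α (g⁻¹ v)`. -/
def dualAct {𝕜 V G : Type*} [RCLike 𝕜] [NormedAddCommGroup V] [NormedSpace 𝕜 V] [Group G]
    (ρ : G →* (V ≃ₗᵢ[𝕜] V)) (g : G) (α : StrongDual 𝕜 V) : StrongDual 𝕜 V :=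
  α.comp ((ρ g⁻¹).toContinuousLinearEquiv : V →L[𝕜] V)

/-- The assertion of the question for a space `V`: for every linear isometric action `ρ` of the
(discrete) group `G` on `V`, every norm one functional `α ∈ V*` all of whose translates under the
dual action are within `δ / 10` of it is within `δ` of a `G`-invariant functional. -/
def DualAlmostInvariantNearInvariant (𝕜 V G : Type*) [RCLike 𝕜] [NormedAddCommGroup V]
    [NormedSpace 𝕜 V] [Group G] : Prop :=
  ∀ (ρ : G →* (V ≃ₗᵢ[𝕜] V)) (δ : ℝ), 0 < δ → ∀ α : StrongDual 𝕜 V, ‖α‖ = 1 →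
    (∀ g : G, ‖dualAct ρ g α - α‖ ≤ δ / 10) →
      ∃ β : StrongDual 𝕜 V, (∀ g : G, dualAct ρ g β = β) ∧ ‖α - β‖ ≤ δ

/-- The vector functional `x ↦ ⟪ξ, x η⟫` on a von Neumann algebra `M` acting on `H`. -/
def vectorFunctional {H : Type*} [NormedAddCommGroup H] [InnerProductSpace ℂ H] [CompleteSpace H]
    (M : VonNeumannAlgebra H) (ξ η : H) : StrongDual ℂ M.toStarSubalgebra :=
  (innerSL ℂ ξ).comp ((ContinuousLinearMap.apply ℂ H η).comp
    M.toStarSubalgebra.toSubalgebra.toSubmodule.subtypeL)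

/-- The predual `M_*` of a von Neumann algebra `M` on `H`: the norm-closed linear span, in the
Banach space dual of `M`, of the vector functionals. These are exactly the ultraweakly continuous
(normal) functionals on `M`. -/
def vonNeumannPredual {H : Type*} [NormedAddCommGroup H] [InnerProductSpace ℂ H] [CompleteSpace H]
    (M : VonNeumannAlgebra H) : Submodule ℂ (StrongDual ℂ M.toStarSubalgebra) :=
  (Submodule.span ℂ {φ | ∃ ξ η : H, φ = vectorFunctional M ξ η}).topologicalClosure

end

/-! The invariant vector is a Chebyshev centre of the orbit of `α`. Let `c` be a bidual point with
`W`-component `w`. Its distance to each `a` in `W` is at least `‖w - a‖ + ‖c - w‖`, so if `c ≠ w`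
then `w` is strictly and uniformly closer to the orbit. Hence all bidual centres of minimal radius
lie in `W`. Weak* compactness makes them a nonempty weakly compact convex set, and this set is
`G`-invariant. The orbit lies in the ball of radius `δ / 10` about `α`, so a fixed centre is within
`δ / 10` of `α`. Only the inequality `HasLComponents` is needed, not the linear splitting.

The fixed point comes from Ryll-Nardzewski (`exists_fixedPoint_of_isCompact_weakSpace`). For a
countable group, Baire category makes a minimal weakly compact invariant set norm totally bounded.
Its closed convex hull is then norm compact, and a diameter argument finishes. Weak compactness
passes from countable groups to all groups.

For a predual `M_*`, evaluation identifies its dual with `M`, so it suffices to split `M*` over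
`M_*`. This works for every closed translation-stable space of functionals
(`exists_component_of_isTranslationStable`): write a functional as a coefficient of the universal
representation and split one vector into a normal part and an orthogonal part. The norms add because
algebra elements approximate the projection onto the normal part (`norm_coeff_add_coeff`).

For `C(X)*`, as for the dual of any C⋆-algebra, restriction is an isometry from the predual of the
bicommutant of the universal representation onto the dual, so the predual case transfers. -/

/-! ## Minimal invariant compact sets -/

section

open Set Filter Topology

/-- Zorn's lemma for compact sets: a property of sets stable under intersections of nonempty
families has a minimal nonempty compact instance inside every compact instance. -/
theorem exists_minimal_isCompact {T : Type*} [TopologicalSpace T] [T2Space T] (Q : Set T → Prop)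
    (hQ : ∀ c : Set (Set T), c.Nonempty → (∀ s ∈ c, Q s) → Q (⋂₀ c))
    {K : Set T} (hK : IsCompact K) (hne : K.Nonempty) (hQK : Q K) :
    ∃ X ⊆ K, IsCompact X ∧ X.Nonempty ∧ Q X ∧
      ∀ Y ⊆ X, IsCompact Y → Y.Nonempty → Q Y → Y = X := by
  obtain ⟨X, hXK, hX⟩ := zorn_superset_nonempty {X : Set T | IsCompact X ∧ X.Nonempty ∧ Q X}
    (fun c hc hchain hcne ↦ by
      have : Nonempty c := hcne.to_subtype
      refine ⟨⋂₀ c, ⟨?_, ?_, hQ c hcne fun s hs ↦ (hc hs).2.2⟩, fun s hs ↦ sInter_subset_of_mem hs⟩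
      · obtain ⟨s, hs⟩ := hcne
        exact (hc hs).1.of_isClosed_subset (isClosed_sInter fun t ht ↦ (hc ht).1.isClosed)
          (sInter_subset_of_mem hs)
      · exact IsCompact.nonempty_sInter_of_directed_nonempty_isCompact_isClosed
          (fun s hs t ht ↦ (hchain.total hs ht).elim (fun h ↦ ⟨s, hs, subset_rfl, h⟩)
            fun h ↦ ⟨t, ht, h, subset_rfl⟩) (fun s hs ↦ (hc hs).2.1) (fun s hs ↦ (hc hs).1)
          (fun s hs ↦ (hc hs).1.isClosed)) K ⟨hK, hne, hQK⟩
  exact ⟨X, hXK, hX.prop.1, hX.prop.2.1, hX.prop.2.2, fun Y hY h1 h2 h3 ↦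
    hY.antisymm (hX.le_of_le ⟨h1, h2, h3⟩ hY)⟩

/-- In a minimal compact invariant set, one of countably many closed sets covering it has finitely
many translates that cover it. -/
theorem exists_finite_translates_cover {T G : Type*} [TopologicalSpace T] [T2Space T] [Group G]
    (a : G → T → T) (ha : ∀ g, Continuous (a g)) (ha1 : ∀ x, a 1 x = x)
    (hmul : ∀ g h x, a (g * h) x = a g (a h x)) {X : Set T} (hX : IsCompact X) (hne : X.Nonempty)
    (hinv : ∀ g, ∀ x ∈ X, a g x ∈ X)
    (hmin : ∀ Y ⊆ X, IsCompact Y → Y.Nonempty → (∀ g, ∀ x ∈ Y, a g x ∈ Y) → Y = X)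
    {ι : Type*} [Countable ι] (F : ι → Set T) (hF : ∀ i, IsClosed (F i)) (hcov : X ⊆ ⋃ i, F i) :
    ∃ i, ∃ s : Finset G, X ⊆ ⋃ g ∈ s, a g '' F i := by
  have : CompactSpace X := isCompact_iff_compactSpace.mp hX
  have : Nonempty X := hne.to_subtype
  -- Baire category in the compact Hausdorff space `X`: some `F i` has interior relative to `X`. By
  -- minimality the translates of that interior cover `X`.
  obtain ⟨i, y, hy⟩ := nonempty_interior_of_iUnion_of_closed (X := X)
    (f := fun i ↦ Subtype.val ⁻¹' F i) (fun i ↦ (hF i).preimage continuous_subtype_val) (by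
      rw [← preimage_iUnion]
      exact eq_univ_of_forall fun x ↦ hcov x.2)
  obtain ⟨U, hU, hUi⟩ := isOpen_induced_iff.mp (isOpen_interior (s := (Subtype.val ⁻¹' F i : Set X)))
  have hUF : U ∩ X ⊆ F i := fun x hx ↦ by
    have : (⟨x, hx.2⟩ : X) ∈ Subtype.val ⁻¹' U := hx.1
    rw [hUi] at this
    exact interior_subset (s := (Subtype.val ⁻¹' F i : Set X)) this
  have hyU : (y : T) ∈ U := by
    have : y ∈ Subtype.val ⁻¹' U := by rw [hUi]; exact hy
    exact this
  have hopen : ∀ g, IsOpen (a g ⁻¹' U) := fun g ↦ hU.preimage (ha g)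
  have hsub : X ⊆ ⋃ g, a g ⁻¹' U := by
    by_contra hcon
    obtain ⟨x, hx, hxU⟩ := not_subset.mp hcon
    have := hmin (X \ ⋃ g, a g ⁻¹' U) sdiff_subset (hX.diff (isOpen_iUnion hopen)) ⟨x, hx, hxU⟩
      (fun g z hz ↦ ⟨hinv g z hz.1, fun h ↦ hz.2 (by
        obtain ⟨k, hk⟩ := mem_iUnion.mp h
        exact mem_iUnion.mpr ⟨k * g, by simpa [hmul] using hk⟩)⟩)
    exact (this.symm ▸ y.2 : (y : T) ∈ X \ ⋃ g, a g ⁻¹' U).2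
      (mem_iUnion.mpr ⟨1, by simpa [ha1] using hyU⟩)
  obtain ⟨t, ht⟩ := hX.elim_finite_subcover _ hopen hsub
  classical
  refine ⟨i, t.image (·⁻¹), fun x hx ↦ ?_⟩
  obtain ⟨g, hg, hgx⟩ := mem_iUnion₂.mp (ht hx)
  refine mem_iUnion₂.mpr ⟨g⁻¹, Finset.mem_image_of_mem _ hg, a g x, hUF ⟨hgx, hinv g x hx⟩, ?_⟩
  rw [← hmul, inv_mul_cancel, ha1]

theorem apply_apply_eq_mul {𝕜 W G : Type*} [RCLike 𝕜] [NormedAddCommGroup W] [NormedSpace 𝕜 W]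
    [Group G] (ρ : G →* (W ≃ₗᵢ[𝕜] W)) (g h : G) (x : W) : ρ g (ρ h x) = ρ (g * h) x := by
  rw [map_mul]; rfl

/-- A group of linear isometries preserving a nonempty norm-compact convex set has a fixed point in
it. -/
theorem exists_fixedPoint_of_isCompact_convex {𝕜 W G : Type*} [RCLike 𝕜] [NormedAddCommGroup W]
    [NormedSpace ℝ W] [NormedSpace 𝕜 W] [Group G] (ρ : G →* (W ≃ₗᵢ[𝕜] W)) {K : Set W} (hK : IsCompact K) (hne : K.Nonempty)
    (hconv : Convex ℝ K) (hinv : ∀ g, ∀ x ∈ K, ρ g x ∈ K) :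
    ∃ x ∈ K, ∀ g, ρ g x = x := by
  obtain ⟨X, hXK, hX, hXne, ⟨hXc, hXi⟩, hmin⟩ := exists_minimal_isCompact
    (fun s : Set W ↦ Convex ℝ s ∧ ∀ g, ∀ x ∈ s, ρ g x ∈ s)
    (fun c _ h ↦ ⟨convex_sInter fun s hs ↦ (h s hs).1, fun g x hx s hs ↦ (h s hs).2 g x (hx s hs)⟩)
    hK hne ⟨hconv, hinv⟩
  obtain ⟨x, hx⟩ := hXne
  suffices hsub : X.Subsingleton from ⟨x, hXK hx, fun g ↦ hsub (hXi g x hx) hx⟩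
  by_contra hsub
  have hd : 0 < Metric.diam X := by
    refine lt_of_le_of_ne Metric.diam_nonneg fun h ↦ hsub fun a ha b hb ↦ ?_
    have := Metric.dist_le_diam_of_mem hX.isBounded ha hb
    exact dist_le_zero.mp (this.trans h.symm.le)
  set d := Metric.diam X
  obtain ⟨t, htX, htf, htc⟩ := finite_cover_balls_of_compact hX (e := d / 2) (by positivity)
  lift t to Finset W using htf
  have htne : t.Nonempty := by
    rcases t.eq_empty_or_nonempty with rfl | h
    · simpa using htc hx
    · exact h
  have hn : (0 : ℝ) < t.card := by exact_mod_cast htne.card_pos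
  set n : ℝ := (t.card : ℝ)
  set c : W := ∑ z ∈ t, (1 / n) • z
  have hcX : c ∈ X := hXc.sum_mem (fun _ _ ↦ by positivity) (by simp [n, hn.ne']) (fun z hz ↦ htX hz)
  -- Seen from any point of `X`, one of the `n` net points is within `d / 2` and the others within
  -- `d`. So the barycentre `c` is within `(d / 2 + (n - 1) * d) / n = r < d` of all of `X`.
  set r := d - d / (2 * n)
  have hrd : r < d := by simp only [r]; linarith [show 0 < d / (2 * n) by positivity]
  have hcr : ∀ y ∈ X, dist c y ≤ r := by
    intro y hy
    obtain ⟨z₀, hz₀, hyz⟩ := mem_iUnion₂.mp (htc hy)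
    have h1 : c - y = ∑ z ∈ t, (1 / n) • (z - y) := by
      simp only [c, smul_sub, Finset.sum_sub_distrib, Finset.sum_const, ← Nat.cast_smul_eq_nsmul ℝ,
        smul_smul]
      simp [n, hn.ne']
    have h2 : ∀ z ∈ t, dist z y ≤ d := fun z hz ↦
      Metric.dist_le_diam_of_mem hX.isBounded (htX hz) hy
    classical
    calc dist c y = ‖∑ z ∈ t, (1 / n) • (z - y)‖ := by rw [dist_eq_norm, h1]
      _ ≤ ∑ z ∈ t, (1 / n) * dist z y := (norm_sum_le _ _).trans_eq <| Finset.sum_congr rfl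
          fun z _ ↦ by rw [norm_smul, dist_eq_norm, Real.norm_of_nonneg (by positivity)]
      _ = (1 / n) * ∑ z ∈ t, dist z y := by rw [Finset.mul_sum]
      _ ≤ (1 / n) * (d / 2 + (n - 1) * d) := by
          gcongr
          rw [← Finset.add_sum_erase _ _ hz₀]
          gcongr
          · rw [dist_comm]; exact (Metric.mem_ball.mp hyz).le
          · refine (Finset.sum_le_card_nsmul _ _ d fun z hz ↦ h2 z (Finset.mem_of_mem_erase hz)).trans ?_
            rw [nsmul_eq_mul, Finset.card_erase_of_mem hz₀,
              Nat.cast_sub (Finset.card_pos.mpr htne), Nat.cast_one]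
      _ = r := by simp only [r]; field_simp; ring
  -- The points of `X` within `r` of all of `X` form an invariant compact convex set containing `c`.
  -- By minimality it is `X`, forcing the diameter down to `r`.
  have hY := hmin (X ∩ ⋂ y ∈ X, Metric.closedBall y r) inter_subset_left
    (hX.inter_right (isClosed_biInter fun y _ ↦ Metric.isClosed_closedBall))
    ⟨c, hcX, mem_iInter₂.mpr fun y hy ↦ hcr y hy⟩
    ⟨hXc.inter (convex_iInter₂ fun y _ ↦ convex_closedBall y r), fun g z hz ↦ ⟨hXi g z hz.1,
      mem_iInter₂.mpr fun y hy ↦ ?_⟩⟩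
  · have : d ≤ r := Metric.diam_le_of_forall_dist_le
      ((dist_nonneg).trans (hcr c hcX)) fun a ha b hb ↦ by
        rw [← hY] at ha
        exact mem_iInter₂.mp ha.2 b hb
    linarith
  · have h3 := mem_iInter₂.mp hz.2 (ρ g⁻¹ y) (hXi _ y hy)
    have h4 : ρ g (ρ g⁻¹ y) = y := by
      rw [apply_apply_eq_mul, mul_inv_cancel, map_one]; rfl
    rw [Metric.mem_closedBall] at h3 ⊢
    rw [← (ρ g).dist_map, h4] at h3
    exact h3

end

/-! ## The Ryll-Nardzewski fixed point theorem for isometric actions -/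

section

open Set Filter Topology

theorem countable_closure {G : Type*} [Group G] {s : Set G} (hs : s.Countable) :
    Countable (Subgroup.closure s) := by
  have := hs.to_subtype
  have : Countable (FreeGroup s) :=
    (Quot.mk_surjective : Function.Surjective (FreeGroup.mk (α := s))).countable
  have h := FreeGroup.range_lift_eq_closure (f := ((↑) : s → G))
  rw [Subtype.range_coe] at h
  rw [← h]
  exact (FreeGroup.lift _).rangeRestrict_surjective.countable

/-- Mazur's theorem: the norm and weak closures of a convex set agree. -/
theorem isClosed_image_toWeakSpace {𝕜 W : Type*} [RCLike 𝕜] [NormedAddCommGroup W]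
    [NormedSpace ℝ W] [NormedSpace 𝕜 W] [IsScalarTower ℝ 𝕜 W] {s : Set W} (hs : IsClosed s)
    (hc : Convex ℝ s) : IsClosed (toWeakSpace 𝕜 W '' s) := by
  have := hc.toWeakSpace_closure 𝕜
  rw [hs.closure_eq] at this
  rw [this]
  exact isClosed_closure

/-- Countability makes the closed span of an orbit separable, so countably many small balls cover a
minimal invariant weakly compact set. These balls are weakly closed, and isometries carry them to
balls of the same radius, so finitely many suffice and the norm-compact case applies to the closed
convex hull. -/
theorem exists_fixedPoint_of_countable {𝕜 W G : Type*} [RCLike 𝕜] [NormedAddCommGroup W]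
    [NormedSpace ℝ W] [NormedSpace 𝕜 W] [IsScalarTower ℝ 𝕜 W] [CompleteSpace W] [Group G]
    [Countable G] (ρ : G →* (W ≃ₗᵢ[𝕜] W)) {C : Set W} (hC : IsCompact (toWeakSpace 𝕜 W '' C))
    (hCne : C.Nonempty) (hCc : Convex ℝ C) (hCi : ∀ g, ∀ x ∈ C, ρ g x ∈ C) :
    ∃ x ∈ C, ∀ g, ρ g x = x := by
  set e := toWeakSpace 𝕜 W with he
  have hCcl : IsClosed C := by
    have := hC.isClosed.preimage (toWeakSpaceCLM 𝕜 W).continuous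
    rwa [show toWeakSpaceCLM 𝕜 W ⁻¹' (e '' C) = e ⁻¹' (e '' C) from rfl,
      preimage_image_eq _ e.injective] at this
  obtain ⟨x₀, hx₀⟩ := hCne
  let S : Submodule 𝕜 W := (Submodule.span 𝕜 (range fun g ↦ ρ g x₀)).topologicalClosure
  have hSsep : TopologicalSpace.IsSeparable (S : Set W) := by
    rw [Submodule.topologicalClosure_coe]
    exact ((countable_range _).isSeparable.span (R := 𝕜)).closure
  have hSi : ∀ g, ∀ x ∈ S, ρ g x ∈ S := by
    intro g
    have h1 : Submodule.span 𝕜 (range fun g ↦ ρ g x₀) ≤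
        S.comap ((ρ g).toLinearEquiv : W →ₗ[𝕜] W) := by
      rw [Submodule.span_le]
      rintro _ ⟨k, rfl⟩
      refine Submodule.le_topologicalClosure _ (Submodule.subset_span ⟨g * k, ?_⟩)
      exact (apply_apply_eq_mul ρ g k x₀).symm
    exact Submodule.topologicalClosure_minimal _ h1
      ((Submodule.isClosed_topologicalClosure _).preimage (ρ g).continuous)
  let D : Set W := C ∩ S
  have hDc : Convex ℝ D := hCc.inter (S.restrictScalars ℝ).convex
  have hDcl : IsClosed D := hCcl.inter (Submodule.isClosed_topologicalClosure _)
  have hD : IsCompact (e '' D) :=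
    hC.of_isClosed_subset (isClosed_image_toWeakSpace hDcl hDc) (image_mono inter_subset_left)
  have hx₀S : x₀ ∈ S := Submodule.le_topologicalClosure _
    (Submodule.subset_span ⟨1, by simp⟩)
  let a : G → WeakSpace 𝕜 W → WeakSpace 𝕜 W := fun g ↦
    WeakSpace.map ((ρ g).toContinuousLinearEquiv : W →L[𝕜] W)
  have hae : ∀ g x, a g (e x) = e (ρ g x) := fun g x ↦ rfl
  have ha : ∀ g, Continuous (a g) := fun g ↦ (WeakSpace.map _).continuous
  obtain ⟨X, hXD, hX, hXne, hXi, hmin⟩ := exists_minimal_isCompact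
    (fun s : Set (WeakSpace 𝕜 W) ↦ ∀ g, ∀ x ∈ s, a g x ∈ s)
    (fun c _ h g x hx s hs ↦ h s hs g x (hx s hs)) hD ⟨e x₀, x₀, ⟨hx₀, hx₀S⟩, rfl⟩ (by
      rintro g _ ⟨x, hx, rfl⟩
      exact ⟨ρ g x, ⟨hCi g x hx.1, hSi g x hx.2⟩, rfl⟩)
  obtain ⟨q, hq, hSq⟩ := hSsep
  have htb : TotallyBounded (e ⁻¹' X) := by
    rw [Metric.totallyBounded_iff]
    intro ε hε
    have := hq.to_subtype
    obtain ⟨i, s, hs⟩ := exists_finite_translates_cover a ha (fun x ↦ by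
        obtain ⟨x, rfl⟩ := e.surjective x
        rw [hae, map_one]; rfl) (fun g h x ↦ by
        obtain ⟨x, rfl⟩ := e.surjective x
        rw [hae, hae, hae, apply_apply_eq_mul]) hX hXne hXi hmin
      (fun y : q ↦ e '' Metric.closedBall (y : W) (ε / 2))
      (fun y ↦ isClosed_image_toWeakSpace Metric.isClosed_closedBall (convex_closedBall _ _))
      (fun x hx ↦ by
        obtain ⟨x, hxD, rfl⟩ := hXD hx
        obtain ⟨y, hy, hxy⟩ := Metric.mem_closure_iff.mp (hSq hxD.2) (ε / 2) (by positivity)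
        exact mem_iUnion.mpr ⟨⟨y, hy⟩, x, hxy.le, rfl⟩)
    classical
    refine ⟨s.image fun g ↦ ρ g i, Finset.finite_toSet _, fun x hx ↦ ?_⟩
    obtain ⟨g, hg, _, ⟨y, hy, rfl⟩, hyx⟩ := mem_iUnion₂.mp (hs hx)
    rw [hae] at hyx
    have hyx := e.injective hyx
    refine mem_iUnion₂.mpr ⟨ρ g i, by simpa using ⟨g, hg, rfl⟩, ?_⟩
    rw [← hyx, Metric.mem_ball, (ρ g).dist_map]
    exact (Metric.mem_closedBall.mp hy).trans_lt (by linarith)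
  have hXC : e ⁻¹' X ⊆ C := fun x hx ↦ by
    obtain ⟨y, hy, hyx⟩ := hXD hx
    exact e.injective hyx ▸ hy.1
  obtain ⟨x, hx, hfix⟩ := exists_fixedPoint_of_isCompact_convex ρ
    (K := closure (convexHull ℝ (e ⁻¹' X)))
    (htb.convexHull.closure.isCompact_of_isClosed isClosed_closure)
    (by
      obtain ⟨x, hx⟩ := hXne
      obtain ⟨x, rfl⟩ := e.surjective x
      exact ⟨x, subset_closure (subset_convexHull ℝ _ hx)⟩)
    (convex_convexHull ℝ _).closure
    (fun g ↦ by
      let f : W →L[ℝ] W := ((ρ g).toContinuousLinearEquiv : W →L[𝕜] W).restrictScalars ℝ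
      have h1 : MapsTo f (convexHull ℝ (e ⁻¹' X)) (convexHull ℝ (e ⁻¹' X)) := by
        rw [mapsTo_iff_image_subset]
        rw [show f '' convexHull ℝ (e ⁻¹' X) = convexHull ℝ (f '' (e ⁻¹' X)) from
          f.toLinearMap.image_convexHull _]
        refine convexHull_mono ?_
        rintro _ ⟨x, hx, rfl⟩
        exact hXi g _ hx
      exact h1.closure f.continuous)
  exact ⟨x, closure_minimal (convexHull_min hXC hCc) hCcl hx, hfix⟩

/-- **Ryll-Nardzewski theorem** for groups of linear isometries: such a group preserving a nonempty
weakly compact convex set has a fixed point in it. -/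
theorem exists_fixedPoint_of_isCompact_weakSpace {𝕜 W G : Type*} [RCLike 𝕜] [NormedAddCommGroup W]
    [NormedSpace ℝ W] [NormedSpace 𝕜 W] [IsScalarTower ℝ 𝕜 W] [CompleteSpace W] [Group G]
    (ρ : G →* (W ≃ₗᵢ[𝕜] W)) {C : Set W} (hC : IsCompact (toWeakSpace 𝕜 W '' C))
    (hCne : C.Nonempty) (hCc : Convex ℝ C) (hCi : ∀ g, ∀ x ∈ C, ρ g x ∈ C) :
    ∃ x ∈ C, ∀ g, ρ g x = x := by
  let Fix : G → Submodule 𝕜 W := fun g ↦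
    LinearMap.eqLocus ((ρ g).toLinearEquiv : W →ₗ[𝕜] W) LinearMap.id
  have hFix : ∀ g x, x ∈ Fix g ↔ ρ g x = x := fun g x ↦ Iff.rfl
  -- The fixed spaces are weakly closed, so by compactness finitely many group elements suffice.
  -- They generate a countable subgroup.
  obtain ⟨_, ⟨x, hx, rfl⟩, hfix⟩ := hC.inter_iInter_nonempty (fun g ↦ toWeakSpace 𝕜 W '' Fix g)
    (fun g ↦ isClosed_image_toWeakSpace
      (isClosed_eq (ρ g).continuous continuous_id) ((Fix g).restrictScalars ℝ).convex)
    (fun u ↦ by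
      let H := Subgroup.closure (u : Set G)
      have : Countable H := countable_closure u.countable_toSet
      obtain ⟨x, hx, hfix⟩ := exists_fixedPoint_of_countable (ρ.comp H.subtype) hC hCne hCc
        (fun g ↦ hCi g)
      exact ⟨toWeakSpace 𝕜 W x, ⟨x, hx, rfl⟩, mem_iInter₂.mpr fun g hg ↦
        ⟨x, hfix ⟨g, Subgroup.subset_closure hg⟩, rfl⟩⟩)
  refine ⟨x, hx, fun g ↦ ?_⟩
  obtain ⟨y, hy, hyx⟩ := mem_iInter.mp hfix g
  exact (toWeakSpace 𝕜 W).injective hyx ▸ hy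

end

/-! ## L-embedded spaces -/

section

open Set Filter Topology NormedSpace

/-- Every element of the bidual has a component in `W` realising the `ℓ¹`-splitting of its distances
to the points of `W`. -/
def HasLComponents (𝕜 W : Type*) [RCLike 𝕜] [NormedAddCommGroup W] [NormedSpace 𝕜 W] : Prop :=
  ∀ c : StrongDual 𝕜 (StrongDual 𝕜 W), ∃ w : W, ∀ a : W,
    ‖w - a‖ + ‖c - inclusionInDoubleDual 𝕜 W w‖ ≤ ‖c - inclusionInDoubleDual 𝕜 W a‖

theorem norm_inclusionInDoubleDual {𝕜 W : Type*} [RCLike 𝕜] [NormedAddCommGroup W]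
    [NormedSpace 𝕜 W] (w : W) : ‖inclusionInDoubleDual 𝕜 W w‖ = ‖w‖ :=
  (inclusionInDoubleDualLi (E := W) 𝕜).norm_map w

theorem norm_inclusionInDoubleDual_sub {𝕜 W : Type*} [RCLike 𝕜] [NormedAddCommGroup W]
    [NormedSpace 𝕜 W] (v w : W) :
    ‖inclusionInDoubleDual 𝕜 W v - inclusionInDoubleDual 𝕜 W w‖ = ‖v - w‖ := by
  rw [← norm_inclusionInDoubleDual (𝕜 := 𝕜) (v - w)]
  congr 1
  ext f
  simp

theorem IsLEmbedded.hasLComponents {𝕜 W : Type*} [RCLike 𝕜] [NormedAddCommGroup W]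
    [NormedSpace 𝕜 W] (h : IsLEmbedded 𝕜 W) : HasLComponents 𝕜 W := by
  obtain ⟨W₀, hcompl, hnorm⟩ := h
  intro c
  obtain ⟨_, z, ⟨w, rfl⟩, hz, hc⟩ := Submodule.codisjoint_iff_exists_add_eq.mp hcompl.codisjoint c
  refine ⟨w, fun a ↦ ?_⟩
  have h1 : c - inclusionInDoubleDual 𝕜 W w = z := by
    rw [← hc]
    ext f
    simp
  have h2 : c - inclusionInDoubleDual 𝕜 W a = inclusionInDoubleDual 𝕜 W (w - a) + z := by
    rw [← h1]
    ext f
    simp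
  rw [h1, h2, hnorm _ _ hz]

/-- The Chebyshev centres in the bidual of a bounded subset of `W` lie in `W` and form a weakly
compact set. -/
theorem HasLComponents.exists_chebyshev {𝕜 W ι : Type*} [RCLike 𝕜] [NormedAddCommGroup W]
    [NormedSpace 𝕜 W] (h : HasLComponents 𝕜 W) [Nonempty ι] (p : ι → W) (α : W) (R : ℝ)
    (hR : ∀ i, ‖p i - α‖ ≤ R) :
    ∃ r ≤ R, {w : W | ∀ i, ‖w - p i‖ ≤ r}.Nonempty ∧
      IsCompact (toWeakSpace 𝕜 W '' {w : W | ∀ i, ‖w - p i‖ ≤ r}) := by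
  let J := inclusionInDoubleDual 𝕜 W
  let B : ℝ → Set (StrongDual 𝕜 (StrongDual 𝕜 W)) := fun s ↦ {c | ∀ i, ‖c - J (p i)‖ ≤ s}
  let S : Set ℝ := {s | (B s).Nonempty}
  have hRS : R ∈ S := ⟨J α, fun i ↦ by
    rw [norm_inclusionInDoubleDual_sub, norm_sub_rev]; exact hR i⟩
  have hS0 : ∀ s ∈ S, 0 ≤ s := fun s ⟨c, hc⟩ ↦ (norm_nonneg (c - J (p (Classical.arbitrary ι)))).trans (hc _)
  have hbdd : BddBelow S := ⟨0, hS0⟩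
  let r := sInf S
  have hcpt : ∀ s, IsCompact (WeakDual.toStrongDual ⁻¹' B s) := fun s ↦ by
    have : WeakDual.toStrongDual ⁻¹' B s =
        ⋂ i, WeakDual.toStrongDual ⁻¹' Metric.closedBall (J (p i)) s := by
      ext c
      rw [mem_iInter]
      exact forall_congr' fun i ↦ by
        rw [mem_preimage]
        exact (mem_closedBall_iff_norm (E := StrongDual 𝕜 (StrongDual 𝕜 W))).symm
    rw [this]
    exact (WeakDual.isCompact_closedBall _ _).of_isClosed_subset
      (isClosed_iInter fun i ↦ (WeakDual.isCompact_closedBall _ _).isClosed)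
      (iInter_subset _ (Classical.arbitrary ι))
  have hrne : (B r).Nonempty := by
    have hne : (⋂ s : S, (WeakDual.toStrongDual ⁻¹' B s : Set (WeakDual 𝕜 (StrongDual 𝕜 W)))).Nonempty := by
      have : Nonempty S := ⟨⟨R, hRS⟩⟩
      refine IsCompact.nonempty_iInter_of_directed_nonempty_isCompact_isClosed _ ?_ (fun s ↦ ?_)
        (fun s ↦ hcpt s) (fun s ↦ (hcpt s).isClosed)
      · intro s t
        rcases le_total s t with hst | hst
        · exact ⟨s, subset_rfl, fun c hc i ↦ (hc i).trans hst⟩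
        · exact ⟨t, fun c hc i ↦ (hc i).trans hst, subset_rfl⟩
      · obtain ⟨c, hc⟩ := s.2
        exact ⟨StrongDual.toWeakDual c, hc⟩
    obtain ⟨c, hc⟩ := hne
    refine ⟨WeakDual.toStrongDual c, fun i ↦ le_csInf ⟨R, hRS⟩ fun s hs ↦ ?_⟩
    exact mem_iInter.mp hc ⟨s, hs⟩ i
  -- The component `w` of a centre `c` has radius at most `r - ‖c - J w‖`. Minimality of `r` forces
  -- `c = J w`.
  have hmem : ∀ c ∈ B r, ∃ w : W, c = J w ∧ ∀ i, ‖w - p i‖ ≤ r := by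
    intro c hc
    obtain ⟨w, hw⟩ := h c
    have h1 : ∀ i, ‖w - p i‖ ≤ r - ‖c - J w‖ := fun i ↦ by linarith [hw (p i), hc i]
    have h2 : r - ‖c - J w‖ ∈ S := ⟨J w, fun i ↦ by
      rw [norm_inclusionInDoubleDual_sub]; exact h1 i⟩
    have h3 : ‖c - J w‖ ≤ 0 := by linarith [csInf_le hbdd h2]
    refine ⟨w, sub_eq_zero.mp (norm_le_zero_iff.mp h3), fun i ↦ (h1 i).trans ?_⟩
    linarith [norm_nonneg (c - J w)]
  refine ⟨r, csInf_le hbdd hRS, ?_, ?_⟩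
  · obtain ⟨c, hc⟩ := hrne
    obtain ⟨w, -, hw⟩ := hmem c hc
    exact ⟨w, hw⟩
  -- The weak topology of `W` is induced by the weak* topology of the bidual, where the image is
  -- exactly the compact set `B r`.
  · rw [(isEmbedding_inclusionInDoubleDualWeak 𝕜 W).isCompact_iff]
    convert hcpt r using 1
    ext c
    constructor
    · rintro ⟨_, ⟨w, hw, rfl⟩, rfl⟩ i
      change ‖J w - J (p i)‖ ≤ r
      rw [norm_inclusionInDoubleDual_sub]
      exact hw i
    · intro hc
      obtain ⟨w, hcw, hw⟩ := hmem _ hc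
      exact ⟨toWeakSpace 𝕜 W w, ⟨w, hw, rfl⟩, hcw.symm⟩

theorem HasLComponents.almostInvariantNearInvariant {𝕜 W G : Type*} [RCLike 𝕜]
    [NormedAddCommGroup W] [NormedSpace 𝕜 W] [CompleteSpace W] [Group G]
    (h : HasLComponents 𝕜 W) : AlmostInvariantNearInvariant 𝕜 W G := by
  intro ρ δ hδ α _ hα
  let : NormedSpace ℝ W := NormedSpace.restrictScalars ℝ 𝕜 W
  have : IsScalarTower ℝ 𝕜 W := .of_algebraMap_smul fun _ _ ↦ rfl
  obtain ⟨r, hr, hne, hcpt⟩ := h.exists_chebyshev (fun g ↦ ρ g α) α (δ / 10) hα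
  obtain ⟨β, hβ, hfix⟩ := exists_fixedPoint_of_isCompact_weakSpace ρ hcpt hne
    (by
      rw [show {w : W | ∀ g, ‖w - ρ g α‖ ≤ r} = ⋂ g, Metric.closedBall (ρ g α) r by
        ext; simp [dist_eq_norm]]
      exact convex_iInter fun g ↦ convex_closedBall _ _)
    (fun g w hw k ↦ by
      have h1 : ρ k α = ρ g (ρ (g⁻¹ * k) α) := by rw [apply_apply_eq_mul, mul_inv_cancel_left]
      rw [h1, ← map_sub, LinearIsometryEquiv.norm_map]
      exact hw _)
  refine ⟨β, hfix, ?_⟩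
  -- `α` is itself a point of its orbit, so the centre `β` is within `r` of it.
  have := hβ 1
  rw [map_one] at this
  rw [norm_sub_rev]
  exact (this.trans hr).trans (by linarith)

/-- The dual action, as a homomorphism to the linear isometries of the dual space. -/
def dualIsometryHom {𝕜 V G : Type*} [RCLike 𝕜] [NormedAddCommGroup V] [NormedSpace 𝕜 V] [Group G]
    (ρ : G →* (V ≃ₗᵢ[𝕜] V)) : G →* (StrongDual 𝕜 V ≃ₗᵢ[𝕜] StrongDual 𝕜 V) where
  toFun g :=
    { toFun := dualAct ρ g
      invFun := dualAct ρ g⁻¹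
      map_add' := fun _ _ ↦ rfl
      map_smul' := fun _ _ ↦ rfl
      left_inv := fun α ↦ by
        ext v
        change α (ρ g⁻¹ (ρ g⁻¹⁻¹ v)) = α v
        rw [apply_apply_eq_mul, mul_inv_cancel, map_one, LinearIsometryEquiv.coe_one, id]
      right_inv := fun α ↦ by
        ext v
        change α (ρ g⁻¹⁻¹ (ρ g⁻¹ v)) = α v
        rw [apply_apply_eq_mul, inv_mul_cancel, map_one, LinearIsometryEquiv.coe_one, id]
      norm_map' := fun α ↦ by
        exact ContinuousLinearMap.opNorm_comp_linearIsometryEquiv α (ρ g⁻¹) }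
  map_one' := by
    ext α v
    change α (ρ 1⁻¹ v) = α v
    rw [inv_one, map_one, LinearIsometryEquiv.coe_one, id]
  map_mul' g h := by
    ext α v
    change α (ρ (g * h)⁻¹ v) = α (ρ h⁻¹ (ρ g⁻¹ v))
    rw [apply_apply_eq_mul, mul_inv_rev]

theorem AlmostInvariantNearInvariant.dual {𝕜 V G : Type*} [RCLike 𝕜] [NormedAddCommGroup V]
    [NormedSpace 𝕜 V] [Group G] (h : AlmostInvariantNearInvariant 𝕜 (StrongDual 𝕜 V) G) :
    DualAlmostInvariantNearInvariant 𝕜 V G :=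
  fun ρ ↦ h (dualIsometryHom ρ)

theorem AlmostInvariantNearInvariant.of_linearIsometryEquiv {𝕜 V W G : Type*} [RCLike 𝕜]
    [NormedAddCommGroup V] [NormedSpace 𝕜 V] [NormedAddCommGroup W] [NormedSpace 𝕜 W] [Group G]
    (e : V ≃ₗᵢ[𝕜] W) (h : AlmostInvariantNearInvariant 𝕜 W G) :
    AlmostInvariantNearInvariant 𝕜 V G := by
  intro ρ δ hδ α hα hρ
  let σ : G →* (W ≃ₗᵢ[𝕜] W) :=
    { toFun := fun g ↦ (e.symm.trans (ρ g)).trans e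
      map_one' := by ext; simp
      map_mul' := fun g h ↦ by ext; simp }
  have hσ : ∀ g v, σ g (e v) = e (ρ g v) := fun g v ↦ by simp [σ]
  obtain ⟨β, hβ, hd⟩ := h σ δ hδ (e α) (by simpa using hα) fun g ↦ by
    rw [hσ, ← map_sub, e.norm_map]; exact hρ g
  obtain ⟨β, rfl⟩ := e.surjective β
  refine ⟨β, fun g ↦ e.injective ((hσ g β).symm.trans (hβ g)), ?_⟩
  rwa [← map_sub, e.norm_map] at hd

end

/-! ## Positive functionals dominating a bounded functional -/

section

open Set Filter Topology ComplexStarModule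
open scoped ComplexOrder InnerProductSpace

section dominate
variable {A : Type*} [CStarAlgebra A] [PartialOrder A] [StarOrderedRing A]

/-- Joint convexity of `star z * z / t`, which makes `dominationCone` closed under addition. The
cross terms are absorbed by a weighted square of `z₂ - (t₂ / t₁) • z₁`. -/
theorem star_add_mul_add_le {z₁ z₂ y₁ y₂ : A} {t₁ t₂ : ℝ} (ht₁ : 0 ≤ t₁) (ht₂ : 0 ≤ t₂)
    (hy₁ : 0 ≤ y₁) (hy₂ : 0 ≤ y₂) (h₁ : star z₁ * z₁ ≤ t₁ • y₁) (h₂ : star z₂ * z₂ ≤ t₂ • y₂) :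
    star (z₁ + z₂) * (z₁ + z₂) ≤ (t₁ + t₂) • (y₁ + y₂) := by
  have key : ∀ {z : A}, star z * z ≤ (0 : ℝ) • (0 : A) → z = 0 := fun {z} hz ↦ by
    rw [smul_zero] at hz
    exact CStarRing.star_mul_self_eq_zero_iff z |>.mp (hz.antisymm (star_mul_self_nonneg z))
  rcases ht₁.eq_or_lt with rfl | ht₁
  · obtain rfl := key (z := z₁) (by simpa using h₁)
    rw [zero_add, zero_add, smul_add]
    exact h₂.trans (le_add_of_nonneg_left (smul_nonneg ht₂ hy₁))
  rcases ht₂.eq_or_lt with rfl | ht₂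
  · obtain rfl := key (z := z₂) (by simpa using h₂)
    rw [add_zero, add_zero, smul_add]
    exact h₁.trans (le_add_of_nonneg_right (smul_nonneg ht₁.le hy₂))
  have e1 : (t₁ / t₂) • (star z₂ * z₂) ≤ t₁ • y₂ := by
    have := smul_le_smul_of_nonneg_left h₂ (show 0 ≤ t₁ / t₂ by positivity)
    rwa [smul_smul, div_mul_cancel₀ _ ht₂.ne'] at this
  have e2 : (t₂ / t₁) • (star z₁ * z₁) ≤ t₂ • y₁ := by
    have := smul_le_smul_of_nonneg_left h₁ (show 0 ≤ t₂ / t₁ by positivity)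
    rwa [smul_smul, div_mul_cancel₀ _ ht₁.ne'] at this
  have e3 : 0 ≤ (t₁ / t₂) • (star (z₂ - (t₂ / t₁) • z₁) * (z₂ - (t₂ / t₁) • z₁)) :=
    smul_nonneg (by positivity) (star_mul_self_nonneg _)
  have e4 : (t₁ / t₂) • (star (z₂ - (t₂ / t₁) • z₁) * (z₂ - (t₂ / t₁) • z₁)) =
      (t₁ / t₂) • (star z₂ * z₂) + (t₂ / t₁) • (star z₁ * z₁) - star z₁ * z₂ - star z₂ * z₁ := by
    have a1 : t₁ / t₂ * (t₂ / t₁) = 1 := by field_simp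
    have a2 : t₁ / t₂ * ((t₂ / t₁) * (t₂ / t₁)) = t₂ / t₁ := by field_simp
    simp only [star_sub, star_smul, star_trivial, sub_mul, mul_sub, smul_sub, smul_mul_assoc,
      mul_smul_comm, smul_smul, a1, a2, one_smul]
    abel
  calc star (z₁ + z₂) * (z₁ + z₂)
      ≤ star (z₁ + z₂) * (z₁ + z₂) +
        (t₁ / t₂) • (star (z₂ - (t₂ / t₁) • z₁) * (z₂ - (t₂ / t₁) • z₁)) :=
        le_add_of_nonneg_right e3
    _ = star z₁ * z₁ + star z₂ * z₂ + (t₁ / t₂) • (star z₂ * z₂) + (t₂ / t₁) • (star z₁ * z₁) := by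
        rw [e4, star_add, add_mul, mul_add, mul_add]; abel
    _ ≤ t₁ • y₁ + t₂ • y₂ + t₁ • y₂ + t₂ • y₁ := by gcongr
    _ = _ := by rw [smul_add, add_smul, add_smul]; abel

/-- The cone on which a state dominating the functional `φ` has to be nonnegative. -/
def dominationCone (φ : StrongDual ℂ A) : PointedCone ℝ (A × ℝ) where
  carrier := {p | ∃ (z y : A) (t l : ℝ), 0 ≤ t ∧ 0 ≤ y ∧ φ z = t ∧ star z * z ≤ t • y ∧
    y + l • 1 ≤ (ℜ p.1 : A) ∧ -t - l ≤ p.2}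
  zero_mem' := ⟨0, 0, 0, 0, by simp⟩
  add_mem' := by
    rintro p q ⟨z₁, y₁, t₁, l₁, ht₁, hy₁, hz₁, h₁, hp₁, hp₁'⟩ ⟨z₂, y₂, t₂, l₂, ht₂, hy₂, hz₂, h₂, hp₂, hp₂'⟩
    refine ⟨z₁ + z₂, y₁ + y₂, t₁ + t₂, l₁ + l₂, add_nonneg ht₁ ht₂, add_nonneg hy₁ hy₂, ?_,
      star_add_mul_add_le ht₁ ht₂ hy₁ hy₂ h₁ h₂, ?_, ?_⟩
    · rw [map_add, hz₁, hz₂]; simp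
    · rw [Prod.fst_add, map_add, AddSubgroup.coe_add, add_smul]
      calc _ = (y₁ + l₁ • 1) + (y₂ + l₂ • (1 : A)) := by abel
        _ ≤ _ := add_le_add hp₁ hp₂
    · rw [Prod.snd_add]; linarith
  smul_mem' := by
    rintro ⟨c, hc⟩ p ⟨z, y, t, l, ht, hy, hz, h, hp, hp'⟩
    refine ⟨c • z, c • y, c * t, c * l, by positivity, smul_nonneg hc hy, ?_, ?_, ?_, ?_⟩
    · have : φ (c • z) = c • φ z := map_real_smul φ φ.continuous c z
      rw [this, hz]; simp
    · rw [star_smul, star_trivial, smul_mul_smul, smul_smul,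
        show c * t * c = c * c * t by ring, ← smul_smul (c * c)]
      exact smul_le_smul_of_nonneg_left h (by positivity)
    · have := smul_le_smul_of_nonneg_left hp hc
      change c • y + (c * l) • (1 : A) ≤ ((ℜ (c • p.1) : selfAdjoint A) : A)
      rw [map_smul, selfAdjoint.val_smul, ← smul_smul, ← smul_add]
      exact this
    · change -(c * t) - c * l ≤ c * p.2
      nlinarith

/-- The compatibility condition for the Riesz extension. Here `0 ≤ y ≤ -l` gives `‖y‖ ≤ -l`, while
`t ≤ ‖z‖` and `‖z‖ ^ 2 ≤ t * ‖y‖` give `t ≤ ‖y‖`. Hence `μ ≥ -t - l ≥ 0`. -/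
theorem dominationCone_nonneg [Nontrivial A] {φ : StrongDual ℂ A} (hφ : ‖φ‖ ≤ 1) {μ : ℝ}
    (h : ((0 : A), μ) ∈ dominationCone φ) : 0 ≤ μ := by
  obtain ⟨z, y, t, l, ht, hy, hz, h, hp, hp'⟩ := h
  simp only [map_zero, ZeroMemClass.coe_zero] at hp
  have hyl : y ≤ algebraMap ℝ A (-l) := by
    rw [map_neg, Algebra.algebraMap_eq_smul_one]
    exact (le_sub_iff_add_le.mpr hp).trans_eq (zero_sub _)
  have hl : 0 ≤ -l := by
    have := hy.trans hyl
    by_contra hcon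
    have h2 : 0 ≤ l • (1 : A) := smul_nonneg (by linarith) zero_le_one
    rw [map_neg, Algebra.algebraMap_eq_smul_one, neg_nonneg] at this
    have h3 := smul_eq_zero.mp (this.antisymm h2)
    rcases h3 with h3 | h3
    · exact hcon (by linarith)
    · exact one_ne_zero h3
  have hyn : ‖y‖ ≤ -l := (CStarAlgebra.norm_le_iff_le_algebraMap y hl).mpr hyl
  have h1 : t ≤ ‖z‖ := by
    have : ‖φ z‖ ≤ ‖z‖ := (φ.le_opNorm z).trans (mul_le_of_le_one_left (norm_nonneg _) hφ)
    rwa [hz, Complex.norm_real, Real.norm_of_nonneg ht] at this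
  have h2 : ‖z‖ * ‖z‖ ≤ t * ‖y‖ := by
    rw [← CStarRing.norm_star_mul_self]
    refine (CStarAlgebra.norm_le_norm_of_nonneg_of_le (star_mul_self_nonneg z) h).trans ?_
    rw [norm_smul, Real.norm_of_nonneg ht]
  have h3 : t ≤ ‖y‖ := by
    by_contra! h4
    nlinarith [norm_nonneg y]
  change -t - l ≤ μ at hp'
  linarith

/-- M. Riesz extension of `(0, c) ↦ c` to a functional nonnegative on the cone; its restriction to
the first factor, complexified, is `f`. Each required inequality is nonnegativity at one explicit
point of the cone. -/
theorem exists_positive_dominating_of_norm_le_one {φ : StrongDual ℂ A} (hφ : ‖φ‖ ≤ 1) :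
    ∃ f : A →ₚ[ℂ] ℂ, (f 1).re ≤ 1 ∧ ∀ x, ‖φ x‖ ^ 2 ≤ (f (star x * x)).re := by
  rcases subsingleton_or_nontrivial A with hA | hA
  · refine ⟨0, by simp, fun x ↦ by simp [Subsingleton.elim x 0]⟩
  have hne : ((0 : A), (1 : ℝ)) ≠ 0 := by simp
  obtain ⟨g, hg1, hg⟩ := riesz_extension (dominationCone φ)
    (LinearPMap.mkSpanSingleton ((0 : A), (1 : ℝ)) (1 : ℝ) hne)
    (by
      rintro ⟨x, hx⟩ hxs
      obtain ⟨c, rfl⟩ := Submodule.mem_span_singleton.mp hx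
      rw [LinearPMap.mkSpanSingleton'_apply]
      have := dominationCone_nonneg hφ (μ := c) (by simpa using hxs)
      simpa using this)
    (by
      rintro ⟨h, μ⟩
      have h1 := IsSelfAdjoint.neg_algebraMap_norm_le_self (a := (ℜ h : A)) (ℜ h).2
      refine ⟨⟨(‖(ℜ h : A)‖ - μ) • ((0 : A), (1 : ℝ)), Submodule.mem_span_singleton.mpr ⟨_, rfl⟩⟩,
        0, 0, 0, -‖(ℜ h : A)‖, le_rfl, le_rfl, by simp, by simp, ?_, by simp⟩
      simpa [Algebra.algebraMap_eq_smul_one] using h1)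
  have hg1 : g (0, 1) = 1 := by
    have := hg1 ⟨(0, 1), Submodule.mem_span_singleton_self _⟩
    rw [this]
    exact LinearPMap.mkSpanSingleton_apply ℝ ℝ hne (1 : ℝ)
  let f₀ : Module.Dual ℝ A := g ∘ₗ LinearMap.inl ℝ A ℝ
  have hgf : ∀ h μ, g (h, μ) = f₀ h + μ := fun h μ ↦ by
    have : ((h, μ) : A × ℝ) = (h, 0) + μ • (0, 1) := by simp
    rw [this, map_add, map_smul, hg1]
    simp [f₀]
  have hpos : ∀ h : A, 0 ≤ (ℜ h : A) → 0 ≤ f₀ h := fun h hh ↦ by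
    have := hg (h, 0) ⟨0, 0, 0, 0, le_rfl, le_rfl, by simp, by simp, by simpa using hh, by simp⟩
    simpa [hgf] using this
  have hsa : ∀ h : A, IsSelfAdjoint h → f₀.extendRCLike (𝕜 := ℂ) h = (f₀ h : ℂ) := fun h hh ↦ by
    have h0 : (ℜ (Complex.I • h) : A) = 0 := by
      rw [realPart_I_smul, hh.imaginaryPart]
      simp
    -- Both signs of an element with zero real part lie in the cone, so `f₀` vanishes there.
    have h1 : f₀ (Complex.I • h) = 0 := by
      refine le_antisymm ?_ (hpos _ h0.ge)
      have := hpos (-(Complex.I • h)) (by rw [map_neg, AddSubgroup.coe_neg, h0, neg_zero])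
      rw [map_neg] at this
      linarith
    rw [Module.Dual.extendRCLike_apply]
    change (f₀ h : ℂ) - Complex.I * (f₀ (Complex.I • h) : ℂ) = _
    rw [h1]; simp
  let f : A →ₚ[ℂ] ℂ := PositiveLinearMap.mk₀ (f₀.extendRCLike (𝕜 := ℂ)) fun x hx ↦ by
    have hxs : IsSelfAdjoint x := .of_nonneg hx
    rw [hsa x hxs]
    exact_mod_cast hpos x (by rwa [hxs.coe_realPart])
  have hf : ∀ h, IsSelfAdjoint h → (f h).re = f₀ h := fun h hh ↦ by
    change (f₀.extendRCLike (𝕜 := ℂ) h).re = _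
    rw [hsa h hh, Complex.ofReal_re]
  refine ⟨f, ?_, fun x ↦ ?_⟩
  · rw [hf 1 (.one A)]
    have := hg (-1, 1) ⟨0, 0, 0, -1, le_rfl, le_rfl, by simp, by simp, by
      simp, by simp⟩
    rw [hgf, map_neg] at this
    linarith
  · rw [hf _ (.star_mul_self x)]
    -- Rotating `x` by the conjugate of `φ x` makes `φ z = ‖φ x‖ ^ 2` real and `star z * z = t • y`
    -- an equality.
    have := hg (star x * x, -‖φ x‖ ^ 2) ⟨star (φ x) • x, star x * x, ‖φ x‖ ^ 2, 0, by positivity,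
      star_mul_self_nonneg x, ?_, ?_, ?_, by simp⟩
    · rw [hgf] at this
      linarith
    · simp [← Complex.conj_mul', mul_comm]
    · rw [star_smul, star_star, smul_mul_smul]
      refine le_of_eq ?_
      rw [Complex.star_def, Complex.mul_conj']
      rw [← Complex.ofReal_pow, Complex.coe_smul]
    · simp [(IsSelfAdjoint.star_mul_self x).coe_realPart]

end dominate

end

/-! ## Representations and their coefficients -/

section

open Set Filter Topology ComplexStarModule
open scoped ComplexOrder InnerProductSpace

section representations

/-- The vector of a finite Hilbert sum with the given components. -/
def lpOfFinite {ι : Type*} [Finite ι] {E : ι → Type*} [∀ i, NormedAddCommGroup (E i)]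
    (v : ∀ i, E i) : lp E 2 := ⟨v, Memℓp.all v⟩

@[simp]
theorem lpOfFinite_apply {ι : Type*} [Finite ι] {E : ι → Type*} [∀ i, NormedAddCommGroup (E i)]
    (v : ∀ i, E i) (i : ι) : lpOfFinite v i = v i := rfl

variable {A : Type*} [CStarAlgebra A]
  {K : Type*} [NormedAddCommGroup K] [InnerProductSpace ℂ K] [CompleteSpace K]

/-- A `*`-representation, as a continuous linear map. -/
noncomputable def repCLM (π : A →⋆ₐ[ℂ] (K →L[ℂ] K)) : A →L[ℂ] (K →L[ℂ] K) :=
  LinearMap.mkContinuous (π : A →ₗ[ℂ] (K →L[ℂ] K)) 1 fun a ↦ by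
    rw [one_mul]; exact NonUnitalStarAlgHom.norm_apply_le π a

/-- The matrix coefficient `x ↦ ⟪ξ, π x η⟫` of a representation. -/
noncomputable def coeff (π : A →⋆ₐ[ℂ] (K →L[ℂ] K)) (ξ η : K) : StrongDual ℂ A :=
  (innerSL ℂ ξ).comp ((ContinuousLinearMap.apply ℂ K η).comp (repCLM π))

@[simp]
theorem coeff_apply (π : A →⋆ₐ[ℂ] (K →L[ℂ] K)) (ξ η : K) (x : A) : coeff π ξ η x = ⟪ξ, π x η⟫_ℂ :=
  rfl

theorem norm_rep_apply_le (π : A →⋆ₐ[ℂ] (K →L[ℂ] K)) (x : A) (v : K) : ‖π x v‖ ≤ ‖x‖ * ‖v‖ :=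
  (π x).le_of_opNorm_le (NonUnitalStarAlgHom.norm_apply_le π x) v

theorem rep_mul_apply (π : A →⋆ₐ[ℂ] (K →L[ℂ] K)) (x y : A) (v : K) : π (x * y) v = π x (π y v) := by
  rw [map_mul]; rfl

theorem rep_inner_left (π : A →⋆ₐ[ℂ] (K →L[ℂ] K)) (x : A) (v w : K) :
    ⟪π x v, w⟫_ℂ = ⟪v, π (star x) w⟫_ℂ := by
  rw [map_star, ContinuousLinearMap.star_eq_adjoint, ContinuousLinearMap.adjoint_inner_right]

theorem coeff_add_right (π : A →⋆ₐ[ℂ] (K →L[ℂ] K)) (ξ η η' : K) :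
    coeff π ξ (η + η') = coeff π ξ η + coeff π ξ η' := by
  ext x; simp

theorem continuous_coeff_left (π : A →⋆ₐ[ℂ] (K →L[ℂ] K)) (η : K) :
    Continuous fun ξ ↦ coeff π ξ η := by
  unfold coeff; fun_prop

theorem continuous_coeff_right (π : A →⋆ₐ[ℂ] (K →L[ℂ] K)) (ξ : K) :
    Continuous fun η ↦ coeff π ξ η := by
  unfold coeff; fun_prop

/-! ### Hilbert sums of representations -/

section sum

variable {ι : Type*} {E : ι → Type*} [∀ i, NormedAddCommGroup (E i)]
  [∀ i, InnerProductSpace ℂ (E i)] [∀ i, CompleteSpace (E i)]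

theorem memℓp_rep (π : ∀ i, A →⋆ₐ[ℂ] (E i →L[ℂ] E i)) (a : A) (v : lp E 2) :
    Memℓp (fun i ↦ π i a (v i)) 2 := by
  have h := ((lp.memℓp v).norm).const_mul ‖a‖
  exact h.mono fun i ↦ norm_rep_apply_le (π i) a (v i)

/-- The action of an element of the algebra on a Hilbert sum of representations. -/
noncomputable def sumRepFun (π : ∀ i, A →⋆ₐ[ℂ] (E i →L[ℂ] E i)) (a : A) : lp E 2 →L[ℂ] lp E 2 :=
  LinearMap.mkContinuous
    { toFun := fun v ↦ ⟨fun i ↦ π i a (v i), memℓp_rep π a v⟩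
      map_add' := fun v w ↦ by ext i; simp; rfl
      map_smul' := fun c v ↦ by ext i; simp } ‖a‖ fun v ↦ by
    refine lp.norm_le_of_forall_sum_le (p := 2) (by norm_num) (by positivity) fun s ↦ ?_
    calc ∑ i ∈ s, ‖π i a (v i)‖ ^ (2 : ENNReal).toReal
        ≤ ∑ i ∈ s, ‖a‖ ^ (2 : ENNReal).toReal * ‖v i‖ ^ (2 : ENNReal).toReal := by
          gcongr with i
          rw [← Real.mul_rpow (norm_nonneg _) (norm_nonneg _)]
          exact Real.rpow_le_rpow (norm_nonneg _) (norm_rep_apply_le (π i) a (v i)) (by norm_num)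
      _ = ‖a‖ ^ (2 : ENNReal).toReal * ∑ i ∈ s, ‖v i‖ ^ (2 : ENNReal).toReal := by
          rw [Finset.mul_sum]
      _ ≤ ‖a‖ ^ (2 : ENNReal).toReal * ‖v‖ ^ (2 : ENNReal).toReal := by
          gcongr
          exact lp.sum_rpow_le_norm_rpow (by norm_num) v s
      _ = _ := by rw [Real.mul_rpow (norm_nonneg _) (norm_nonneg _)]

@[simp]
theorem sumRepFun_apply (π : ∀ i, A →⋆ₐ[ℂ] (E i →L[ℂ] E i)) (a : A) (v : lp E 2) (i : ι) :
    sumRepFun π a v i = π i a (v i) := rfl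

/-- The Hilbert sum of a family of representations. -/
noncomputable def sumRep (π : ∀ i, A →⋆ₐ[ℂ] (E i →L[ℂ] E i)) : A →⋆ₐ[ℂ] (lp E 2 →L[ℂ] lp E 2) where
  toFun := sumRepFun π
  map_one' := by ext v i; simp
  map_mul' a b := by ext v i; simp
  map_zero' := by ext v i; simp
  map_add' a b := by ext v i; simp
  commutes' r := by ext v i; simp [Algebra.algebraMap_eq_smul_one]
  map_star' a := by
    rw [ContinuousLinearMap.star_eq_adjoint, ContinuousLinearMap.eq_adjoint_iff]
    intro v w
    rw [lp.inner_eq_tsum, lp.inner_eq_tsum]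
    refine tsum_congr fun i ↦ ?_
    simp only [sumRepFun_apply]
    rw [rep_inner_left, star_star]

@[simp]
theorem sumRep_apply (π : ∀ i, A →⋆ₐ[ℂ] (E i →L[ℂ] E i)) (a : A) (v : lp E 2) (i : ι) :
    sumRep π a v i = π i a (v i) := rfl

theorem coeff_sumRep_single_left [DecidableEq ι] (π : ∀ i, A →⋆ₐ[ℂ] (E i →L[ℂ] E i)) (i : ι)
    (ξ : E i) (v : lp E 2) : coeff (sumRep π) (lp.single 2 i ξ) v = coeff (π i) ξ (v i) := by
  ext x
  rw [coeff_apply, lp.inner_single_left, coeff_apply, sumRep_apply]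

/-- This turns a finite sum of coefficients into one coefficient of a multiple of the
representation, so facts about single coefficients apply to sums. -/
theorem coeff_sumRep_of_fintype [Fintype ι] (π : ∀ i, A →⋆ₐ[ℂ] (E i →L[ℂ] E i)) (v w : lp E 2) :
    coeff (sumRep π) v w = ∑ i, coeff (π i) (v i) (w i) := by
  ext x
  simp [lp.inner_eq_tsum, tsum_fintype]

end sum

/-! ### The part of a representation whose coefficients lie in a given space of functionals -/

/-- A space of functionals stable under two-sided translations `φ ↦ φ (a · b)`. -/
def IsTranslationStable (F : Submodule ℂ (StrongDual ℂ A)) : Prop :=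
  ∀ φ ∈ F, ∀ a b : A, φ.comp (ContinuousLinearMap.mulLeftRight ℂ A a b) ∈ F

/-- The vectors all of whose coefficients lie in `F`. -/
def normalPart (F : Submodule ℂ (StrongDual ℂ A)) (π : A →⋆ₐ[ℂ] (K →L[ℂ] K)) : Submodule ℂ K where
  carrier := {η | ∀ ξ, coeff π ξ η ∈ F}
  zero_mem' ξ := by
    convert F.zero_mem
    ext x; simp
  add_mem' h h' ξ := by
    rw [coeff_add_right]
    exact F.add_mem (h ξ) (h' ξ)
  smul_mem' c η h ξ := by
    have : coeff π ξ (c • η) = c • coeff π ξ η := by ext x; simp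
    rw [this]
    exact F.smul_mem c (h ξ)

variable {F : Submodule ℂ (StrongDual ℂ A)} {π : A →⋆ₐ[ℂ] (K →L[ℂ] K)}

theorem mem_normalPart {η : K} : η ∈ normalPart F π ↔ ∀ ξ, coeff π ξ η ∈ F := Iff.rfl

theorem isClosed_normalPart (hF : IsClosed (F : Set (StrongDual ℂ A))) :
    IsClosed (normalPart F π : Set K) := by
  have : (normalPart F π : Set K) = ⋂ ξ, (fun η ↦ coeff π ξ η) ⁻¹' F := by
    ext η; simp [mem_normalPart]
  rw [this]
  exact isClosed_iInter fun ξ ↦ hF.preimage (continuous_coeff_right π ξ)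

theorem coeff_comp_mulLeftRight (π : A →⋆ₐ[ℂ] (K →L[ℂ] K)) (ξ η : K) (a b : A) :
    (coeff π ξ η).comp (ContinuousLinearMap.mulLeftRight ℂ A a b) =
      coeff π (π (star a) ξ) (π b η) := by
  ext x
  rw [coeff_apply, rep_inner_left, star_star, ← rep_mul_apply, ← rep_mul_apply]
  simp [mul_assoc]

theorem rep_mem_normalPart (hb : IsTranslationStable F) (a : A) {η : K} (hη : η ∈ normalPart F π) :
    π a η ∈ normalPart F π := fun ξ ↦ by
  have := hb _ (hη ξ) 1 a
  rwa [coeff_comp_mulLeftRight, star_one, map_one] at this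

theorem rep_mem_orthogonal {S : Submodule ℂ K} (hS : ∀ a, ∀ v ∈ S, π a v ∈ S) (a : A) {η : K}
    (hη : η ∈ Sᗮ) : π a η ∈ Sᗮ := fun v hv ↦ by
  have := hη _ (hS (star a) v hv)
  rwa [rep_inner_left, star_star] at this

/-- The closed cyclic subspace generated by a vector. -/
noncomputable def cyclicSubspace (π : A →⋆ₐ[ℂ] (K →L[ℂ] K)) (θ : K) : Submodule ℂ K :=
  ((ContinuousLinearMap.apply ℂ K θ).comp (repCLM π)).range.topologicalClosure

theorem isClosed_cyclicSubspace (π : A →⋆ₐ[ℂ] (K →L[ℂ] K)) (θ : K) :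
    IsClosed (cyclicSubspace π θ : Set K) := Submodule.isClosed_topologicalClosure _

instance (π : A →⋆ₐ[ℂ] (K →L[ℂ] K)) (θ : K) : CompleteSpace (cyclicSubspace π θ) :=
  (isClosed_cyclicSubspace π θ).completeSpace_coe

theorem rep_apply_mem_cyclicSubspace (π : A →⋆ₐ[ℂ] (K →L[ℂ] K)) (θ : K) (a : A) :
    π a θ ∈ cyclicSubspace π θ := Submodule.le_topologicalClosure _ ⟨a, rfl⟩

theorem cyclicSubspace_le {θ : K} {S : Submodule ℂ K} (hS : IsClosed (S : Set K))
    (h : ∀ a, π a θ ∈ S) : cyclicSubspace π θ ≤ S :=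
  Submodule.topologicalClosure_minimal _ (by rintro _ ⟨a, rfl⟩; exact h a) hS

theorem rep_mem_cyclicSubspace (π : A →⋆ₐ[ℂ] (K →L[ℂ] K)) (θ : K) (a : A) {v : K}
    (hv : v ∈ cyclicSubspace π θ) : π a v ∈ cyclicSubspace π θ := by
  refine cyclicSubspace_le (S := (cyclicSubspace π θ).comap (π a : K →ₗ[ℂ] K))
    ((isClosed_cyclicSubspace π θ).preimage (π a).continuous) (fun b ↦ ?_) hv
  have := rep_apply_mem_cyclicSubspace π θ (a * b)
  rwa [rep_mul_apply] at this

theorem starProjection_cyclicSubspace_rep (π : A →⋆ₐ[ℂ] (K →L[ℂ] K)) (θ : K) (a : A) (v : K) :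
    (cyclicSubspace π θ).starProjection (π a v) = π a ((cyclicSubspace π θ).starProjection v) := by
  refine Submodule.eq_starProjection_of_mem_orthogonal
    (rep_mem_cyclicSubspace π θ a (Submodule.starProjection_apply_mem _ v)) ?_
  rw [← map_sub]
  exact rep_mem_orthogonal (fun a v hv ↦ rep_mem_cyclicSubspace π θ a hv) a
    (Submodule.sub_starProjection_mem_orthogonal v)

/-- A coefficient lying in `F` of a vector orthogonal to the normal part vanishes. -/
theorem coeff_eq_zero_of_mem (hF : IsClosed (F : Set (StrongDual ℂ A))) (hb : IsTranslationStable F)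
    {θ η : K} (hη : η ∈ (normalPart F π)ᗮ) (h : coeff π θ η ∈ F) : coeff π θ η = 0 := by
  let S := cyclicSubspace π θ
  have h1 : ∀ ζ ∈ S, coeff π ζ η ∈ F := fun ζ hζ ↦ by
    refine closure_minimal (t := (fun ζ ↦ coeff π ζ η) ⁻¹' F) ?_
      (hF.preimage (continuous_coeff_left π η)) hζ
    rintro _ ⟨a, rfl⟩
    have := hb _ h (star a) 1
    rwa [coeff_comp_mulLeftRight, star_star, map_one] at this
  -- The projection onto `S` commutes with `π` and so can be moved to the left vector. Its value at
  -- `η` is normal, hence orthogonal to `η`, hence zero.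
  have h2 : S.starProjection η ∈ normalPart F π := fun ζ ↦ by
    have : coeff π ζ (S.starProjection η) = coeff π (S.starProjection ζ) η := by
      ext x
      rw [coeff_apply, coeff_apply, ← starProjection_cyclicSubspace_rep, S.inner_starProjection_left_eq_right]
    rw [this]
    exact h1 _ (S.starProjection_apply_mem ζ)
  have h3 : S.starProjection η = 0 := by
    have h4 : ⟪S.starProjection η, S.starProjection η⟫_ℂ = 0 := by
      rw [S.inner_starProjection_left_eq_right,
        S.starProjection_eq_self_iff.mpr (S.starProjection_apply_mem η),
        ← S.inner_starProjection_left_eq_right]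
      exact hη _ h2
    exact inner_self_eq_zero.mp h4
  ext x
  have h5 : S.starProjection (π (star x) θ) = π (star x) θ :=
    S.starProjection_eq_self_iff.mpr (rep_apply_mem_cyclicSubspace π θ _)
  rw [coeff_apply, ← star_star x, ← rep_inner_left, ← h5, S.inner_starProjection_left_eq_right, h3]
  simp

end representations

end

/-! ## Separation of the normal part by contractions -/

section

open Set Filter Topology ComplexStarModule
open scoped ComplexOrder InnerProductSpace

section separation

variable {A : Type*} [CStarAlgebra A]
  {K : Type*} [NormedAddCommGroup K] [InnerProductSpace ℂ K] [CompleteSpace K]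
  {F : Submodule ℂ (StrongDual ℂ A)} {π : A →⋆ₐ[ℂ] (K →L[ℂ] K)}

theorem mem_normalPart_sumRep {ι : Type*} [Fintype ι] {v : lp (fun _ : ι ↦ K) 2}
    (h : ∀ i, v i ∈ normalPart F π) : v ∈ normalPart F (sumRep fun _ : ι ↦ π) := fun ξ ↦ by
  rw [coeff_sumRep_of_fintype]
  exact F.sum_mem fun i _ ↦ h i _

/-- Testing a normal vector of the multiple against vectors supported in one summand shows that its
coordinates are normal. -/
theorem mem_orthogonal_normalPart_sumRep {ι : Type*} {v : lp (fun _ : ι ↦ K) 2}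
    (h : ∀ i, v i ∈ (normalPart F π)ᗮ) : v ∈ (normalPart F (sumRep fun _ : ι ↦ π))ᗮ := by
  classical
  intro w hw
  rw [lp.inner_eq_tsum]
  refine (tsum_congr fun i ↦ ?_).trans tsum_zero
  refine h i _ fun ξ ↦ ?_
  have := hw (lp.single 2 i ξ)
  rwa [coeff_sumRep_single_left (fun _ : ι ↦ π)] at this

theorem eq_zero_of_selfAdjoint {φ : StrongDual ℂ A} (h : ∀ s, IsSelfAdjoint s → φ s = 0) : φ = 0 := by
  ext x
  rw [← realPart_add_I_smul_imaginaryPart x, map_add, map_smul, h _ (ℜ x).2, h _ (ℑ x).2]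
  simp

/-- A self-adjoint element acting approximately as the projection to the normal part on a given
vector. -/
theorem exists_selfAdjoint_approx_add (hF : IsClosed (F : Set (StrongDual ℂ A)))
    (hb : IsTranslationStable F) {p q : K} (hp : p ∈ normalPart F π) (hq : q ∈ (normalPart F π)ᗮ)
    {ε : ℝ} (hε : 0 < ε) : ∃ s : A, IsSelfAdjoint s ∧ ‖π s (p + q) - p‖ < ε := by
  let : InnerProductSpace ℝ K := InnerProductSpace.rclikeToReal ℂ K
  let R : Submodule ℝ K := (((ContinuousLinearMap.apply ℂ K (p + q)).comp
    (repCLM π)).toLinearMap.restrictScalars ℝ ∘ₗ (selfAdjoint.submodule ℝ A).subtype).range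
  let S := R.topologicalClosure
  have hScl : IsClosed (S : Set K) := R.isClosed_topologicalClosure
  have : CompleteSpace S := hScl.completeSpace_coe
  suffices hpS : p ∈ S by
    obtain ⟨_, ⟨s, rfl⟩, hs⟩ := Metric.mem_closure_iff.mp hpS ε hε
    refine ⟨s, s.2, ?_⟩
    rw [dist_comm, dist_eq_norm] at hs
    exact hs
  -- The aim is `u = 0`. Real orthogonality to `R` says that `coeff π u (p + q) + coeff π (p + q) u`
  -- vanishes on self-adjoint elements, hence everywhere.
  obtain ⟨p', hp', u, hu, hpu⟩ := Submodule.exists_add_mem_mem_orthogonal (𝕜 := ℝ) (K := S) p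
  have hre : ∀ s, IsSelfAdjoint s → (⟪u, π s (p + q)⟫_ℂ).re = 0 := fun s hs ↦ by
    have := hu (π s (p + q)) (R.le_topologicalClosure ⟨⟨s, hs⟩, rfl⟩)
    rw [real_inner_comm] at this
    exact this
  have hc : ∀ s, IsSelfAdjoint s → ⟪p + q, π s u⟫_ℂ = star ⟪u, π s (p + q)⟫_ℂ := fun s hs ↦ by
    rw [← inner_conj_symm, rep_inner_left, hs.star_eq]; rfl
  have : CompleteSpace (normalPart F π) := (isClosed_normalPart hF).completeSpace_coe
  obtain ⟨un, hun, us, hus, rfl⟩ := (normalPart F π).exists_add_mem_mem_orthogonal u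
  have hzero : coeff π (un + us) (p + q) + coeff π (p + q) (un + us) = 0 :=
    eq_zero_of_selfAdjoint fun s hs ↦ by
      rw [add_apply, coeff_apply, coeff_apply, hc s hs]
      have := hre s hs
      generalize ⟪un + us, π s (p + q)⟫_ℂ = z at this
      apply Complex.ext <;> simp [this]
  let Θ : lp (fun _ : Fin 2 ↦ K) 2 := lpOfFinite ![un + us, p + q]
  have hΘ : ∀ x y, coeff (sumRep fun _ : Fin 2 ↦ π) Θ (lpOfFinite ![x, y]) =
      coeff π (un + us) x + coeff π (p + q) y := fun x y ↦ by
    simp [coeff_sumRep_of_fintype, Θ]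
  have hn : coeff (sumRep fun _ : Fin 2 ↦ π) Θ (lpOfFinite ![p, un]) ∈ F :=
    mem_normalPart_sumRep (by simp [Fin.forall_fin_two, hp, hun]) Θ
  have hsum : coeff (sumRep fun _ : Fin 2 ↦ π) Θ (lpOfFinite ![p, un]) +
      coeff (sumRep fun _ : Fin 2 ↦ π) Θ (lpOfFinite ![q, us]) = 0 := by
    rw [hΘ, hΘ, ← hzero, coeff_add_right, coeff_add_right]
    abel
  -- The singular half of the identity is minus the normal half, so it lies in `F` and vanishes. The
  -- normal half, evaluated at `1`, gives `Re ⟪u, p⟫ = 0`, that is, `‖u‖ ^ 2 = 0`.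
  have hs : coeff (sumRep fun _ : Fin 2 ↦ π) Θ (lpOfFinite ![q, us]) = 0 :=
    coeff_eq_zero_of_mem hF hb
      (mem_orthogonal_normalPart_sumRep (by simp [Fin.forall_fin_two, hq, hus]))
      (by rw [eq_neg_of_add_eq_zero_right hsum]; exact F.neg_mem hn)
  rw [hs, add_zero, hΘ] at hsum
  have h1 := congr($hsum 1)
  simp only [add_apply, coeff_apply, map_one, one_apply_eq_self, zero_apply, inner_add_left] at h1
  rw [(normalPart F π).inner_left_of_mem_orthogonal hp hus,
    (normalPart F π).inner_left_of_mem_orthogonal hun hq, add_zero, add_zero] at h1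
  have h2 : (⟪un, p⟫_ℂ).re = 0 := by
    have := congr(Complex.re $h1)
    rw [← inner_conj_symm p un] at this
    simp only [Complex.add_re, Complex.conj_re, Complex.zero_re] at this
    linarith
  have h3 : ⟪un + us, p⟫_ℝ = 0 := by
    change (⟪un + us, p⟫_ℂ).re = 0
    rw [inner_add_left, (normalPart F π).inner_left_of_mem_orthogonal hp hus, add_zero, h2]
  have h4 : un + us = 0 := by
    rw [hpu, inner_add_right, real_inner_comm, hu p' hp', zero_add] at h3
    exact inner_self_eq_zero.mp h3
  rw [hpu, h4, add_zero]
  exact hp'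

/-- Passing to two copies of `π`, with `p` and `q` in different coordinates, separates the two
estimates. -/
theorem exists_selfAdjoint_approx (hF : IsClosed (F : Set (StrongDual ℂ A)))
    (hb : IsTranslationStable F) {p q : K} (hp : p ∈ normalPart F π) (hq : q ∈ (normalPart F π)ᗮ)
    {ε : ℝ} (hε : 0 < ε) : ∃ s : A, IsSelfAdjoint s ∧ ‖π s p - p‖ < ε ∧ ‖π s q‖ < ε := by
  obtain ⟨s, hs, h⟩ := exists_selfAdjoint_approx_add (π := sumRep fun _ : Fin 2 ↦ π) hF hb
    (p := lpOfFinite ![p, 0]) (q := lpOfFinite ![0, q])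
    (mem_normalPart_sumRep (by simp [Fin.forall_fin_two, hp]))
    (mem_orthogonal_normalPart_sumRep (by simp [Fin.forall_fin_two, hq])) hε
  have h0 := (lp.norm_apply_le_norm two_ne_zero _ (0 : Fin 2)).trans_lt h
  have h1 := (lp.norm_apply_le_norm two_ne_zero _ (1 : Fin 2)).trans_lt h
  simp at h0 h1
  exact ⟨s, hs, h0, h1⟩

theorem sq_add_one_sub_sq_pos (t : ℝ) : 0 < t ^ 2 + (1 - t) ^ 2 := by
  nlinarith [sq_nonneg (2 * t - 1)]

theorem abs_div_sq_add_one_sub_sq_le (t : ℝ) : |t / (t ^ 2 + (1 - t) ^ 2)| ≤ 2 := by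
  have := sq_add_one_sub_sq_pos t
  rw [abs_div, abs_of_pos this, div_le_iff₀ this, abs_le]
  constructor <;> nlinarith [sq_nonneg (8 * t - 3), sq_nonneg (8 * t - 5)]

/-- Elements `e, 1 - e` with `e` positive and contractive acting approximately as the projections to
the normal part and its complement. -/
theorem exists_contraction_approx (hF : IsClosed (F : Set (StrongDual ℂ A)))
    (hb : IsTranslationStable F) {p q : K} (hp : p ∈ normalPart F π) (hq : q ∈ (normalPart F π)ᗮ)
    {ε : ℝ} (hε : 0 < ε) : ∃ e k : A, IsSelfAdjoint e ∧ IsSelfAdjoint k ∧ ‖e * e + k * k‖ ≤ 1 ∧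
      ‖π e p - p‖ < ε ∧ ‖π e q‖ < ε ∧ ‖π k p‖ < ε ∧ ‖π k q - q‖ < ε := by
  obtain ⟨s, hs, hsp, hsq⟩ := exists_selfAdjoint_approx hF hb hp hq (show 0 < ε / 3 by positivity)
  -- There is no control on `‖s‖`, so take `e = s² / D(s)` and `k = (1 - s)² / D(s)`. They are
  -- positive with sum `1`, so `e² + k² ≤ 1`. The factors `r` and `r'` have norm at most `2`, which
  -- is why `ε / 3` is enough.
  let D : ℝ → ℝ := fun t ↦ t ^ 2 + (1 - t) ^ 2
  have hD : ∀ t, D t ≠ 0 := fun t ↦ (sq_add_one_sub_sq_pos t).ne'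
  have hDc : Continuous D := by fun_prop
  let r := cfc (fun t : ℝ ↦ t / D t) s
  let r' := cfc (fun t : ℝ ↦ (1 - t) / D t) s
  let e := cfc (fun t : ℝ ↦ t / D t * t) s
  let k := cfc (fun t : ℝ ↦ (1 - t) / D t * (1 - t)) s
  have c1 : Continuous fun t : ℝ ↦ t / D t := continuous_id.div hDc hD
  have c2 : Continuous fun t : ℝ ↦ (1 - t) / D t := (by fun_prop : Continuous fun t : ℝ ↦ 1 - t).div hDc hD
  have c3 : Continuous fun t : ℝ ↦ t / D t * t := c1.mul continuous_id
  have c4 : Continuous fun t : ℝ ↦ (1 - t) / D t * (1 - t) := c2.mul (by fun_prop)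
  have hr : ‖r‖ ≤ 2 := norm_cfc_le (by norm_num) fun t _ ↦ abs_div_sq_add_one_sub_sq_le t
  have hr' : ‖r'‖ ≤ 2 := norm_cfc_le (by norm_num) fun t _ ↦ by
    have := abs_div_sq_add_one_sub_sq_le (1 - t)
    rwa [sub_sub_cancel, add_comm] at this
  have he : e = r * s := by
    rw [show r * s = r * cfc id s by rw [cfc_id ℝ s], ← cfc_mul _ _ s c1.continuousOn
      continuous_id.continuousOn]
    rfl
  have hk : k = r' * (1 - s) := by
    rw [show r' * (1 - s) = r' * cfc (fun t : ℝ ↦ 1 - t) s by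
      rw [cfc_sub (fun _ : ℝ ↦ (1 : ℝ)) (fun t ↦ t) s, cfc_const_one ℝ s, cfc_id' ℝ s],
      ← cfc_mul _ _ s c2.continuousOn (by fun_prop)]
  have hek : e + k = 1 := by
    rw [← cfc_const_one ℝ s, ← cfc_add s _ _ c3.continuousOn c4.continuousOn]
    refine cfc_congr fun t _ ↦ ?_
    have := hD t
    simp only [D] at this ⊢
    field_simp
  have hsq' : ‖e * e + k * k‖ ≤ 1 := by
    have c3 := c3.continuousOn (s := spectrum ℝ s)
    have c4 := c4.continuousOn (s := spectrum ℝ s)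
    rw [← cfc_mul _ _ s c3 c3, ← cfc_mul _ _ s c4 c4, ← cfc_add s (fun t ↦ t / D t * t * (t / D t * t))
      (fun t ↦ (1 - t) / D t * (1 - t) * ((1 - t) / D t * (1 - t))) (c3.mul c3) (c4.mul c4)]
    refine norm_cfc_le zero_le_one fun t _ ↦ ?_
    rw [Real.norm_of_nonneg (add_nonneg (mul_self_nonneg _) (mul_self_nonneg _))]
    have h1 : t / D t * t + (1 - t) / D t * (1 - t) = 1 := by
      have := hD t
      simp only [D] at this ⊢
      field_simp
    have h2 : 0 ≤ t / D t * t := by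
      rw [div_mul_eq_mul_div]
      exact div_nonneg (mul_self_nonneg t) (sq_add_one_sub_sq_pos t).le
    have h3 : 0 ≤ (1 - t) / D t * (1 - t) := by
      rw [div_mul_eq_mul_div]
      exact div_nonneg (mul_self_nonneg _) (sq_add_one_sub_sq_pos t).le
    nlinarith
  have hkp : ‖π k p‖ < ε := by
    rw [hk, rep_mul_apply]
    refine (norm_rep_apply_le π r' _).trans_lt ?_
    rw [map_sub, map_one, sub_apply, one_apply_eq_self,
      norm_sub_rev]
    nlinarith [norm_nonneg r', norm_nonneg (π s p - p)]
  have heq : ‖π e q‖ < ε := by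
    rw [he, rep_mul_apply]
    refine (norm_rep_apply_le π r _).trans_lt ?_
    nlinarith [norm_nonneg r, norm_nonneg (π s q)]
  refine ⟨e, k, cfc_predicate _ _, cfc_predicate _ _, hsq', ?_, heq, hkp, ?_⟩
  · rw [eq_sub_of_add_eq hek, map_sub, map_one, sub_apply,
      one_apply_eq_self, sub_sub_cancel_left, norm_neg]
    exact hkp
  · rw [eq_sub_of_add_eq' hek, map_sub, map_one, sub_apply,
      one_apply_eq_self, sub_sub_cancel_left, norm_neg]
    exact heq

/-- Cauchy–Schwarz in the Hilbert module `A × A`: the element is the inner product of `(e, k)` and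
`(e * a, k * b)`, both of norm at most `1`. -/
theorem norm_add_conjugate_le [PartialOrder A] [StarOrderedRing A] {e k a b : A}
    (he : IsSelfAdjoint e) (hk : IsSelfAdjoint k) (h : ‖e * e + k * k‖ ≤ 1) (ha : ‖a‖ ≤ 1)
    (hb : ‖b‖ ≤ 1) : ‖e * a * e + k * b * k‖ ≤ 1 := by
  let x : WithCStarModule A (A × A) := (WithCStarModule.equiv A (A × A)).symm (e, k)
  let y : WithCStarModule A (A × A) := (WithCStarModule.equiv A (A × A)).symm (e * a, k * b)
  have hxy := CStarModule.norm_inner_le (A := A) (WithCStarModule A (A × A)) (x := x) (y := y)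
  have h1 : inner A x y = e * a * e + k * b * k := by
    change e * a * star e + k * b * star k = _
    rw [he.star_eq, hk.star_eq]
  have hx : ‖x‖ ≤ 1 := by
    rw [← sq_le_one_iff₀ (norm_nonneg _), WithCStarModule.prod_norm_sq]
    change ‖e * star e + k * star k‖ ≤ 1
    rwa [he.star_eq, hk.star_eq]
  have key : ∀ {e a : A}, IsSelfAdjoint e → ‖a‖ ≤ 1 → e * a * star (e * a) ≤ e * e := by
    intro e a he ha
    have h1 := CStarAlgebra.star_left_conjugate_le_norm_smul (a := e) (b := a * star a)
      (hb := .mul_star_self a)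
    rw [he.star_eq, CStarRing.norm_self_mul_star] at h1
    have h2 : (‖a‖ * ‖a‖) • (e * e) ≤ (1 : ℝ) • (e * e) := by
      refine smul_le_smul_of_nonneg_right ?_ (by simpa [he.star_eq] using star_mul_self_nonneg e)
      nlinarith [norm_nonneg a]
    rw [star_mul, he.star_eq]
    calc e * a * (star a * e) = e * (a * star a) * e := by simp only [mul_assoc]
      _ ≤ _ := h1
      _ ≤ _ := h2
      _ = _ := one_smul _ _
  have hy : ‖y‖ ≤ 1 := by
    rw [← sq_le_one_iff₀ (norm_nonneg _), WithCStarModule.prod_norm_sq]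
    change ‖e * a * star (e * a) + k * b * star (k * b)‖ ≤ 1
    exact (CStarAlgebra.norm_le_norm_of_nonneg_of_le
      (add_nonneg (mul_star_self_nonneg _) (mul_star_self_nonneg _))
      (add_le_add (key he ha) (key hk hb))).trans h
  rw [h1] at hxy
  exact hxy.trans (mul_le_one₀ hx (norm_nonneg _) hy)

end separation

end

/-! ## Translation-stable spaces of functionals are L-summands -/

section

open Set Filter Topology ComplexStarModule
open scoped ComplexOrder InnerProductSpace

section additivity

variable {A : Type*} [CStarAlgebra A]

section

variable {K : Type*} [NormedAddCommGroup K] [InnerProductSpace ℂ K] [CompleteSpace K]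
  {F : Submodule ℂ (StrongDual ℂ A)} {π : A →⋆ₐ[ℂ] (K →L[ℂ] K)}

theorem norm_inner_rep_sub_le {x x' y y' : K} {a : A} {ε : ℝ} (hε : ε ≤ 1) (ha : ‖a‖ ≤ 1)
    (hx : ‖x' - x‖ < ε) (hy : ‖y' - y‖ < ε) :
    ‖⟪x', π a y'⟫_ℂ - ⟪x, π a y⟫_ℂ‖ ≤ ε * (‖x‖ + ‖y‖ + 1) := by
  have h1 : ⟪x', π a y'⟫_ℂ - ⟪x, π a y⟫_ℂ = ⟪x' - x, π a y'⟫_ℂ + ⟪x, π a (y' - y)⟫_ℂ := by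
    rw [map_sub, inner_sub_left, inner_sub_right]; ring
  have hπ : ∀ v, ‖π a v‖ ≤ ‖v‖ := fun v ↦
    (norm_rep_apply_le π a v).trans (mul_le_of_le_one_left (norm_nonneg _) ha)
  have hy' : ‖y'‖ ≤ ‖y‖ + 1 := by
    have := norm_add_le y (y' - y)
    rw [add_sub_cancel] at this
    linarith
  rw [h1]
  calc _ ≤ ‖x' - x‖ * ‖π a y'‖ + ‖x‖ * ‖π a (y' - y)‖ :=
        (norm_add_le _ _).trans (add_le_add (norm_inner_le_norm _ _) (norm_inner_le_norm _ _))
    _ ≤ ε * (‖y‖ + 1) + ‖x‖ * ε := by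
        gcongr
        · exact (norm_nonneg _).trans hx.le
        · exact (hπ _).trans hy'
        · exact (hπ _).trans hy.le
    _ = _ := by ring

theorem norm_coeff_conjugate_sub_le {x y : K} {e k a b : A} {ε : ℝ} (hε : ε ≤ 1)
    (he : IsSelfAdjoint e) (hk : IsSelfAdjoint k) (ha : ‖a‖ ≤ 1) (hb : ‖b‖ ≤ 1)
    (hex : ‖π e x - x‖ < ε) (hey : ‖π e y - y‖ < ε) (hkx : ‖π k x‖ < ε) (hky : ‖π k y‖ < ε) :
    ‖coeff π x y (e * a * e + k * b * k) - coeff π x y a‖ ≤ ε * (‖x‖ + ‖y‖ + 2) := by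
  have h : ∀ {e : A} (a : A), IsSelfAdjoint e →
      coeff π x y (e * a * e) = ⟪π e x, π a (π e y)⟫_ℂ := fun {e} a he ↦ by
    rw [coeff_apply, rep_mul_apply, rep_mul_apply, rep_inner_left, he.star_eq]
  have h1 := norm_inner_rep_sub_le (π := π) hε ha hex hey
  have h2 := norm_inner_rep_sub_le (π := π) (x := 0) (y := 0) hε hb
    (by rwa [sub_zero]) (show ‖π k y - 0‖ < ε by rwa [sub_zero]) (x' := π k x)
  rw [map_add, h a he, h b hk, coeff_apply]
  calc _ = ‖(⟪π e x, π a (π e y)⟫_ℂ - ⟪x, π a y⟫_ℂ) +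
        (⟪π k x, π b (π k y)⟫_ℂ - ⟪0, π b 0⟫_ℂ)‖ := by
        rw [inner_zero_left]; congr 1; ring
    _ ≤ _ := (norm_add_le _ _).trans (add_le_add h1 h2)
    _ = _ := by rw [norm_zero]; ring

/-- For contractions `a` and `b`, the contraction `e * a * e + k * b * k` acts approximately as `a`
on the normal vectors and as `b` on the orthogonal ones. So `χ` and `σ` can be brought near their
norms simultaneously. -/
theorem norm_coeff_add_coeff [PartialOrder A] [StarOrderedRing A]
    (hF : IsClosed (F : Set (StrongDual ℂ A)))
    (hb : IsTranslationStable F) {p p' q q' : K} (hp : p ∈ normalPart F π)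
    (hp' : p' ∈ normalPart F π) (hq : q ∈ (normalPart F π)ᗮ) (hq' : q' ∈ (normalPart F π)ᗮ) :
    ‖coeff π p p'‖ + ‖coeff π q q'‖ ≤ ‖coeff π p p' + coeff π q q'‖ := by
  set χ := coeff π p p' with hχ
  set σ := coeff π q q' with hσ
  have h1 : ∀ a b : A, ‖a‖ ≤ 1 → ‖b‖ ≤ 1 → ‖χ a + σ b‖ ≤ ‖χ + σ‖ := by
    intro a b ha hb1
    set C := (‖p‖ + ‖p'‖ + 2) + (‖q‖ + ‖q'‖ + 2)
    have hC : 0 < C := by positivity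
    refine le_of_forall_pos_le_add fun δ hδ ↦ ?_
    set ε := min 1 (δ / C)
    have hε : 0 < ε := by positivity
    have hε1 : ε ≤ 1 := min_le_left _ _
    have hεC : ε * C ≤ δ := (le_div_iff₀ hC).mp (min_le_right _ _)
    obtain ⟨e, k, he, hk, hek, h1, h2, h3, h4⟩ := exists_contraction_approx
      (π := sumRep fun _ : Fin 2 ↦ π) hF hb (p := lpOfFinite ![p, p']) (q := lpOfFinite ![q, q'])
      (mem_normalPart_sumRep (by simp [Fin.forall_fin_two, hp, hp']))
      (mem_orthogonal_normalPart_sumRep (by simp [Fin.forall_fin_two, hq, hq'])) hε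
    have comp : ∀ {v : lp (fun _ : Fin 2 ↦ K) 2}, ‖v‖ < ε → ∀ i, ‖v i‖ < ε := fun h i ↦
      (lp.norm_apply_le_norm two_ne_zero _ i).trans_lt h
    have e1 := norm_coeff_conjugate_sub_le (π := π) (x := p) (y := p') hε1 he hk ha hb1
      (by simpa using comp h1 0) (by simpa using comp h1 1) (by simpa using comp h3 0)
      (by simpa using comp h3 1)
    have e2 := norm_coeff_conjugate_sub_le (π := π) (x := q) (y := q') hε1 hk he hb1 ha
      (by simpa using comp h4 0) (by simpa using comp h4 1) (by simpa using comp h2 0)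
      (by simpa using comp h2 1)
    rw [add_comm (k * b * k)] at e2
    set c := e * a * e + k * b * k
    have hc : ‖c‖ ≤ 1 := norm_add_conjugate_le he hk hek ha hb1
    have h5 : ‖(χ + σ) c‖ ≤ ‖χ + σ‖ := (χ + σ).unit_le_opNorm c hc
    calc ‖χ a + σ b‖ = ‖(χ + σ) c - ((χ c - χ a) + (σ c - σ b))‖ := by
          rw [add_apply]; congr 1; ring
      _ ≤ ‖(χ + σ) c‖ + (‖χ c - χ a‖ + ‖σ c - σ b‖) :=
          (norm_sub_le _ _).trans (by gcongr; exact norm_add_le _ _)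
      _ ≤ ‖χ + σ‖ + (ε * (‖p‖ + ‖p'‖ + 2) + ε * (‖q‖ + ‖q'‖ + 2)) := by gcongr
      _ = ‖χ + σ‖ + ε * C := by rw [← mul_add]
      _ ≤ _ := by gcongr
  have h2 : ∀ a b : A, ‖a‖ ≤ 1 → ‖b‖ ≤ 1 → ‖χ a‖ + ‖σ b‖ ≤ ‖χ + σ‖ := by
    have phase : ∀ z : ℂ, ∃ u : ℂ, ‖u‖ ≤ 1 ∧ u * z = ‖z‖ := fun z ↦ by
      rcases eq_or_ne z 0 with rfl | hz
      · exact ⟨0, by simp, by simp⟩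
      · refine ⟨‖z‖ / z, by simp [hz], ?_⟩
        field_simp
    intro a b ha hb1
    obtain ⟨u, hu, hua⟩ := phase (χ a)
    obtain ⟨v, hv, hvb⟩ := phase (σ b)
    have := h1 (u • a) (v • b)
      (by rw [norm_smul]; exact mul_le_one₀ hu (norm_nonneg _) ha)
      (by rw [norm_smul]; exact mul_le_one₀ hv (norm_nonneg _) hb1)
    rw [map_smul, map_smul, smul_eq_mul, smul_eq_mul, hua, hvb, ← Complex.ofReal_add,
      Complex.norm_real, Real.norm_of_nonneg (by positivity)] at this
    exact this
  have h3 : ∀ {φ : StrongDual ℂ A} {M : ℝ}, (∀ a, ‖a‖ ≤ 1 → ‖φ a‖ ≤ M) → ‖φ‖ ≤ M := fun {φ M} h ↦ by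
    have hM : 0 ≤ M := (norm_nonneg _).trans (h 0 (by simp))
    exact ContinuousLinearMap.opNorm_le_of_unit_norm hM fun a ha ↦ h a ha.le
  have h4 : ∀ b : A, ‖b‖ ≤ 1 → ‖χ‖ ≤ ‖χ + σ‖ - ‖σ b‖ := fun b hb1 ↦
    h3 fun a ha ↦ by linarith [h2 a b ha hb1]
  have h5 : ‖σ‖ ≤ ‖χ + σ‖ - ‖χ‖ := h3 fun b hb1 ↦ by linarith [h4 b hb1]
  linarith

end

variable [PartialOrder A] [StarOrderedRing A]

/-- Every functional is a matrix coefficient of a GNS representation, with optimal norms. -/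
theorem exists_eq_gns_coeff (φ : StrongDual ℂ A) :
    ∃ (f : A →ₚ[ℂ] ℂ) (ξ η : f.GNS), ‖ξ‖ ≤ ‖φ‖ ∧ ‖η‖ ≤ 1 ∧ coeff f.gnsStarAlgHom ξ η = φ := by
  obtain ⟨f, hf1, hf⟩ : ∃ f : A →ₚ[ℂ] ℂ, (f 1).re ≤ 1 ∧
      ∀ x, ‖φ x‖ ^ 2 ≤ ‖φ‖ ^ 2 * (f (star x * x)).re := by
    rcases eq_or_ne φ 0 with rfl | hφ
    · exact ⟨0, by simp, fun x ↦ by simp⟩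
    have hφ' : 0 < ‖φ‖ := norm_pos_iff.mpr hφ
    obtain ⟨f, hf1, hf⟩ := exists_positive_dominating_of_norm_le_one (φ := ((‖φ‖⁻¹ : ℝ) : ℂ) • φ)
      (by rw [norm_smul, Complex.norm_real, norm_inv, norm_norm, inv_mul_cancel₀ hφ'.ne'])
    refine ⟨f, hf1, fun x ↦ ?_⟩
    have := hf x
    rw [smul_apply, norm_smul, Complex.norm_real, norm_inv, norm_norm, mul_pow,
      inv_pow, inv_mul_le_iff₀ (by positivity)] at this
    exact this
  -- Domination by `f` makes `φ` bounded for the GNS norm. The Riesz representation theorem then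
  -- gives `ξ`, and `η` is the class of `1`.
  let g : f.PreGNS →L[ℂ] ℂ := LinearMap.mkContinuous (φ.toLinearMap ∘ₗ f.ofPreGNS.toLinearMap) ‖φ‖
    fun x ↦ by
      refine le_of_sq_le_sq ?_ (by positivity)
      rw [mul_pow, f.preGNS_norm_def, Real.sq_sqrt]
      · exact hf (f.ofPreGNS x)
      · exact (Complex.nonneg_iff.mp (f.map_nonneg (star_mul_self_nonneg _))).1
  have hg : ‖g‖ ≤ ‖φ‖ := LinearMap.mkContinuous_norm_le _ (norm_nonneg _) _
  let η : f.GNS := (f.toPreGNS 1 : f.PreGNS)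
  let ξ : f.GNS := (InnerProductSpace.toDual ℂ f.GNS).symm g.fromCompletion
  refine ⟨f, ξ, η, ?_, ?_, ?_⟩
  · rw [LinearIsometryEquiv.norm_map]
    refine ContinuousLinearMap.opNorm_le_bound _ (norm_nonneg _) fun x ↦ ?_
    induction x using UniformSpace.Completion.induction_on with
    | hp => exact isClosed_le (by fun_prop) (by fun_prop)
    | ih x =>
      rw [ContinuousLinearMap.fromCompletion_apply_coe, UniformSpace.Completion.norm_coe]
      exact g.le_of_opNorm_le hg x
  · rw [UniformSpace.Completion.norm_coe, f.preGNS_norm_def]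
    simpa using hf1
  · ext x
    have h1 : f.gnsStarAlgHom x η = (f.leftMulMapPreGNS x (f.toPreGNS 1) : f.PreGNS) :=
      f.gnsNonUnitalStarAlgHom_apply_coe
    rw [coeff_apply, InnerProductSpace.toDual_symm_apply, h1,
      ContinuousLinearMap.fromCompletion_apply_coe]
    change φ (x * 1) = φ x
    rw [mul_one]

/-- The Hilbert space of the universal representation. -/
noncomputable abbrev UnivSpace (A : Type*) [CStarAlgebra A] [PartialOrder A] [StarOrderedRing A] :=
  lp (fun f : A →ₚ[ℂ] ℂ ↦ f.GNS) 2

/-- The universal representation, the Hilbert sum of all GNS representations. -/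
noncomputable def univRep (A : Type*) [CStarAlgebra A] [PartialOrder A] [StarOrderedRing A] :
    A →⋆ₐ[ℂ] (UnivSpace A →L[ℂ] UnivSpace A) :=
  sumRep fun f : A →ₚ[ℂ] ℂ ↦ f.gnsStarAlgHom

theorem exists_eq_univRep_coeff (φ : StrongDual ℂ A) :
    ∃ ξ η : UnivSpace A, ‖ξ‖ ≤ ‖φ‖ ∧ ‖η‖ ≤ 1 ∧ coeff (univRep A) ξ η = φ := by
  classical
  obtain ⟨f, ξ, η, hξ, hη, h⟩ := exists_eq_gns_coeff φ
  refine ⟨lp.single 2 f ξ, lp.single 2 f η, ?_, ?_, ?_⟩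
  · rwa [lp.norm_single (by norm_num)]
  · rwa [lp.norm_single (by norm_num)]
  · rw [univRep, coeff_sumRep_single_left, lp.single_apply_self, h]

/-- A closed translation-stable space of functionals on a C⋆-algebra is an `L`-summand of the
dual space. -/
theorem exists_component_of_isTranslationStable {A : Type*} [CStarAlgebra A]
    {F : Submodule ℂ (StrongDual ℂ A)} (hF : IsClosed (F : Set (StrongDual ℂ A)))
    (hb : IsTranslationStable F) (φ : StrongDual ℂ A) :
    ∃ w ∈ F, ∀ a ∈ F, ‖w - a‖ + ‖φ - w‖ ≤ ‖φ - a‖ := by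
  let := CStarAlgebra.spectralOrder A
  have := CStarAlgebra.spectralOrderedRing A
  set π := univRep A
  set N := normalPart F π
  have : CompleteSpace N := (isClosed_normalPart hF).completeSpace_coe
  have hN : ∀ x, ∀ v ∈ N, π x v ∈ N := fun x v hv ↦ rep_mem_normalPart hb x hv
  obtain ⟨ξ, η, -, -, hφ⟩ := exists_eq_univRep_coeff φ
  obtain ⟨ξn, hξn, ξs, hξs, rfl⟩ := N.exists_add_mem_mem_orthogonal ξ
  obtain ⟨ηn, hηn, ηs, hηs, rfl⟩ := N.exists_add_mem_mem_orthogonal η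
  have hw : coeff π (ξn + ξs) ηn ∈ F := hηn _
  refine ⟨_, hw, fun a ha ↦ ?_⟩
  have hσ : φ - coeff π (ξn + ξs) ηn = coeff π ξs ηs := by
    rw [← hφ, coeff_add_right, add_sub_cancel_left]
    ext x
    rw [coeff_apply, coeff_apply, inner_add_left,
      N.inner_right_of_mem_orthogonal hξn (rep_mem_orthogonal hN x hηs), zero_add]
  obtain ⟨θ, ζ, -, -, hχ⟩ := exists_eq_univRep_coeff (coeff π (ξn + ξs) ηn - a)
  have hmem := F.sub_mem hw ha
  obtain ⟨θn, hθn, θs, hθs, rfl⟩ := N.exists_add_mem_mem_orthogonal θ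
  obtain ⟨ζn, hζn, ζs, hζs, rfl⟩ := N.exists_add_mem_mem_orthogonal ζ
  -- An element of `F` is a coefficient of normal vectors: its remaining part is again in `F` but
  -- has an orthogonal right vector.
  have hχ' : coeff π (ξn + ξs) ηn - a = coeff π θn ζn := by
    have h0 : coeff π (θn + θs) ζs = 0 := by
      refine coeff_eq_zero_of_mem hF hb hζs ?_
      have : coeff π (θn + θs) ζs =
          coeff π (ξn + ξs) ηn - a - coeff π (θn + θs) ζn := by
        rw [← hχ, coeff_add_right, add_sub_cancel_left]
      rw [this]
      exact F.sub_mem hmem (hζn _)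
    rw [← hχ, coeff_add_right, h0, add_zero]
    ext x
    rw [coeff_apply, coeff_apply, inner_add_left,
      N.inner_left_of_mem_orthogonal (hN x _ hζn) hθs, add_zero]
  have := norm_coeff_add_coeff hF hb hθn hζn hξs hηs
  rw [← hχ', ← hσ] at this
  rwa [sub_add_sub_cancel'] at this

end additivity

end

/-! ## Preduals of von Neumann algebras -/

section

open Set Filter Topology
open scoped InnerProductSpace

/-- A space `F` of functionals on `A` has L-components if every functional on `A*` restricts on `F`
to the evaluation at a point of `A` and every functional on `A` has an L-component in `F`. -/
theorem hasLComponents_of_evaluation {A D : Type*} [NormedAddCommGroup A] [NormedSpace ℂ A]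
    [NormedAddCommGroup D] [NormedSpace ℂ D] (e : D ≃ₗᵢ[ℂ] StrongDual ℂ A) {F : Submodule ℂ D}
    (hF : ∀ g : StrongDual ℂ D, ∃ T : A, ‖T‖ ≤ ‖g‖ ∧ ∀ φ ∈ F, g φ = e φ T)
    (hc : ∀ φ : D, ∃ w ∈ F, ∀ a ∈ F, ‖w - a‖ + ‖φ - w‖ ≤ ‖φ - a‖) :
    HasLComponents ℂ F := by
  intro c
  let j : F →L[ℂ] StrongDual ℂ A := (e : D →L[ℂ] StrongDual ℂ A).comp F.subtypeL
  let ev : A →L[ℂ] StrongDual ℂ F :=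
    (ContinuousLinearMap.compL ℂ F (StrongDual ℂ A) ℂ).flip j ∘L
      NormedSpace.inclusionInDoubleDual ℂ A
  have hev : ∀ T φ, ev T φ = e φ.1 T := fun _ _ ↦ rfl
  have hevn : ∀ T, ‖ev T‖ ≤ ‖T‖ := fun T ↦
    ContinuousLinearMap.opNorm_le_bound _ (norm_nonneg _) fun φ ↦ by
      rw [hev, mul_comm]
      exact (e φ.1).le_opNorm T |>.trans_eq (by rw [e.norm_map]; rfl)
  -- `hF` and Hahn–Banach make every functional on `F` an evaluation at a point of `A` with no
  -- larger norm. So passing from `c` to `φ` preserves distances to points of `F`.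
  let φ : D := e.symm (c.comp ev)
  have key : ∀ a : F, ∀ T,
      (c - NormedSpace.inclusionInDoubleDual ℂ F a) (ev T) = e (φ - a.1) T := fun a T ↦ by
    rw [map_sub, e.apply_symm_apply]
    rfl
  obtain ⟨w, hw, h⟩ := hc φ
  refine ⟨⟨w, hw⟩, fun a ↦ ?_⟩
  have h1 : ‖c - NormedSpace.inclusionInDoubleDual ℂ F ⟨w, hw⟩‖ ≤ ‖φ - w‖ :=
    ContinuousLinearMap.opNorm_le_bound _ (norm_nonneg (φ - w)) fun f ↦ by
      obtain ⟨g, hgf, hg⟩ := exists_extension_norm_eq F f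
      obtain ⟨T, hT, hgT⟩ := hF g
      have hfT : f = ev T := by
        ext ψ
        rw [← hgf, hgT _ ψ.2, hev]
      calc _ = ‖e (φ - w) T‖ := by rw [hfT]; exact congrArg _ (key ⟨w, hw⟩ T)
        _ ≤ ‖e (φ - w)‖ * ‖T‖ := (e (φ - w)).le_opNorm T
        _ ≤ _ := by rw [← hg, e.norm_map]; gcongr
  have h2 : ‖φ - a.1‖ ≤ ‖c - NormedSpace.inclusionInDoubleDual ℂ F a‖ := by
    rw [← e.norm_map]
    refine ContinuousLinearMap.opNorm_le_bound _ (norm_nonneg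
      (c - NormedSpace.inclusionInDoubleDual ℂ F a)) fun T ↦ ?_
    rw [← key]
    refine (ContinuousLinearMap.le_opNorm _ _).trans ?_
    gcongr
    exact hevn T
  exact (add_le_add le_rfl h1).trans ((h a.1 a.2).trans h2)

section predual

variable {H : Type*} [NormedAddCommGroup H] [InnerProductSpace ℂ H] [CompleteSpace H]
  (M : VonNeumannAlgebra H)

theorem VonNeumannAlgebra.mem_of_commute {M : VonNeumannAlgebra H} {T : H →L[ℂ] H}
    (h : ∀ y ∈ Set.centralizer (M : Set (H →L[ℂ] H)), y * T = T * y) : T ∈ M := by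
  rw [← SetLike.mem_coe, ← M.centralizer_centralizer]
  exact Set.mem_centralizer_iff.mpr h

theorem VonNeumannAlgebra.isClosed : IsClosed (M.toStarSubalgebra : Set (H →L[ℂ] H)) := by
  rw [M.coe_toStarSubalgebra, ← M.centralizer_centralizer]
  exact Set.isClosed_centralizer _

theorem vectorFunctional_apply (ξ η : H) (x : M.toStarSubalgebra) :
    vectorFunctional M ξ η x = ⟪ξ, (x : H →L[ℂ] H) η⟫_ℂ := rfl

theorem norm_vectorFunctional_le (ξ η : H) : ‖vectorFunctional M ξ η‖ ≤ ‖ξ‖ * ‖η‖ :=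
  ContinuousLinearMap.opNorm_le_bound _ (by positivity) fun x ↦ by
    rw [vectorFunctional_apply]
    calc _ ≤ ‖ξ‖ * ‖(x : H →L[ℂ] H) η‖ := norm_inner_le_norm _ _
      _ ≤ ‖ξ‖ * (‖(x : H →L[ℂ] H)‖ * ‖η‖) := by gcongr; exact ContinuousLinearMap.le_opNorm _ _
      _ = _ := by change _ = ‖ξ‖ * ‖η‖ * ‖(x : H →L[ℂ] H)‖; ring

theorem vectorFunctional_mem (ξ η : H) : vectorFunctional M ξ η ∈ vonNeumannPredual M :=
  Submodule.le_topologicalClosure _ (Submodule.subset_span ⟨ξ, η, rfl⟩)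

theorem isClosed_vonNeumannPredual :
    IsClosed (vonNeumannPredual M : Set (StrongDual ℂ M.toStarSubalgebra)) :=
  Submodule.isClosed_topologicalClosure _

theorem vonNeumannPredual_le {F : Submodule ℂ (StrongDual ℂ M.toStarSubalgebra)}
    (hF : IsClosed (F : Set (StrongDual ℂ M.toStarSubalgebra)))
    (h : ∀ ξ η, vectorFunctional M ξ η ∈ F) : vonNeumannPredual M ≤ F :=
  Submodule.topologicalClosure_minimal _
    (Submodule.span_le.mpr (by rintro _ ⟨ξ, η, rfl⟩; exact h ξ η)) hF

/-- The vector functionals as a bounded sesquilinear map. -/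
noncomputable def vectorFunctionalL : H →L⋆[ℂ] H →L[ℂ] StrongDual ℂ M.toStarSubalgebra :=
  LinearMap.mkContinuous₂
    (LinearMap.mk₂'ₛₗ (starRingEnd ℂ) (RingHom.id ℂ) (vectorFunctional M)
      (fun _ _ _ ↦ by ext; simp [vectorFunctional_apply])
      (fun _ _ _ ↦ by ext; simp [vectorFunctional_apply, mul_comm])
      (fun _ _ _ ↦ by ext; simp [vectorFunctional_apply])
      (fun _ _ _ ↦ by ext; simp [vectorFunctional_apply])) 1
    fun ξ η ↦ by rw [one_mul]; exact norm_vectorFunctional_le M ξ η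

/-- Every functional on the dual of a von Neumann algebra acts on the predual as the evaluation at
an element of the algebra of at most the same norm. -/
theorem exists_eq_evaluation (g : StrongDual ℂ (StrongDual ℂ M.toStarSubalgebra)) :
    ∃ T : M.toStarSubalgebra, ‖T‖ ≤ ‖g‖ ∧ ∀ φ ∈ vonNeumannPredual M, g φ = φ T := by
  let B : H →L⋆[ℂ] H →L[ℂ] ℂ :=
    (ContinuousLinearMap.compL ℂ H (StrongDual ℂ M.toStarSubalgebra) ℂ g).comp (vectorFunctionalL M)
  have hB : ∀ ξ η, B ξ η = g (vectorFunctional M ξ η) := fun _ _ ↦ rfl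
  let T : H →L[ℂ] H := ContinuousLinearMap.adjoint (InnerProductSpace.continuousLinearMapOfBilin B)
  have hT : ∀ ξ η, ⟪ξ, T η⟫_ℂ = g (vectorFunctional M ξ η) := fun ξ η ↦ by
    rw [ContinuousLinearMap.adjoint_inner_right,
      InnerProductSpace.continuousLinearMapOfBilin_apply, hB]
  have hnorm : ‖T‖ ≤ ‖g‖ := by
    refine ContinuousLinearMap.opNorm_le_bound _ (norm_nonneg g) fun η ↦ ?_
    have h1 : ‖T η‖ * ‖T η‖ ≤ ‖T η‖ * (‖g‖ * ‖η‖) := by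
      rw [← inner_self_eq_norm_mul_norm (𝕜 := ℂ)]
      refine (RCLike.re_le_norm _).trans ?_
      rw [hT]
      calc _ ≤ ‖g‖ * ‖vectorFunctional M (T η) η‖ := g.le_opNorm _
        _ ≤ ‖g‖ * (‖T η‖ * ‖η‖) := by gcongr; exact norm_vectorFunctional_le M _ _
        _ = _ := by ring
    rcases (norm_nonneg (T η)).eq_or_lt with h | h
    · rw [← h]; positivity
    · exact le_of_mul_le_mul_left h1 h
  -- For `y` in the commutant, the pairs `(y* ξ, η)` and `(ξ, y η)` define the same vector
  -- functional on `M`, so `T` commutes with `y`.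
  have hTM : T ∈ M := VonNeumannAlgebra.mem_of_commute fun y hy ↦ by
    ext η
    refine ext_inner_left ℂ fun ξ ↦ ?_
    change ⟪ξ, y (T η)⟫_ℂ = ⟪ξ, T (y η)⟫_ℂ
    rw [← ContinuousLinearMap.adjoint_inner_left, hT, hT]
    congr 1
    ext x
    rw [vectorFunctional_apply, vectorFunctional_apply, ContinuousLinearMap.adjoint_inner_left]
    have := congr($(Set.mem_centralizer_iff.mp hy x x.2) η)
    exact congrArg _ this.symm
  refine ⟨⟨T, hTM⟩, hnorm, fun φ hφ ↦ ?_⟩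
  have hle : vonNeumannPredual M ≤
      LinearMap.eqLocus (g : StrongDual ℂ M.toStarSubalgebra →ₗ[ℂ] ℂ)
        (ContinuousLinearMap.apply ℂ ℂ (⟨T, hTM⟩ : M.toStarSubalgebra) :
          StrongDual ℂ M.toStarSubalgebra →ₗ[ℂ] ℂ) :=
    vonNeumannPredual_le M (isClosed_eq g.continuous (ContinuousLinearMap.continuous _))
      fun ξ η ↦ (hT ξ η).symm
  exact hle hφ

/-- The predual is translation stable: `x ↦ ⟪ξ, a x b η⟫` is the vector functional of `a* ξ` and `b
η`. -/
theorem vonNeumannPredual_component (φ : StrongDual ℂ M.toStarSubalgebra) :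
    ∃ w ∈ vonNeumannPredual M, ∀ a ∈ vonNeumannPredual M, ‖w - a‖ + ‖φ - w‖ ≤ ‖φ - a‖ := by
  have : IsClosed (M.toStarSubalgebra : Set (H →L[ℂ] H)) := M.isClosed
  refine exists_component_of_isTranslationStable (A := M.toStarSubalgebra)
    (isClosed_vonNeumannPredual M) (fun ψ hψ a b ↦ ?_) φ
  let L : StrongDual ℂ M.toStarSubalgebra →L[ℂ] StrongDual ℂ M.toStarSubalgebra :=
    (ContinuousLinearMap.compL ℂ M.toStarSubalgebra M.toStarSubalgebra ℂ).flip
      (ContinuousLinearMap.mulLeftRight ℂ M.toStarSubalgebra a b)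
  have hle : vonNeumannPredual M ≤ (vonNeumannPredual M).comap
      (L : StrongDual ℂ M.toStarSubalgebra →ₗ[ℂ] StrongDual ℂ M.toStarSubalgebra) := by
    refine vonNeumannPredual_le M ((isClosed_vonNeumannPredual M).preimage L.continuous) fun ξ η ↦ ?_
    have hL : L (vectorFunctional M ξ η) = vectorFunctional M
        (ContinuousLinearMap.adjoint (a : H →L[ℂ] H) ξ) ((b : H →L[ℂ] H) η) := by
      ext x
      rw [vectorFunctional_apply, ContinuousLinearMap.adjoint_inner_left]
      rfl
    change L (vectorFunctional M ξ η) ∈ vonNeumannPredual M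
    rw [hL]
    exact vectorFunctional_mem M _ _
  exact hle hψ

theorem hasLComponents_vonNeumannPredual : HasLComponents ℂ (vonNeumannPredual M) :=
  hasLComponents_of_evaluation (.refl ℂ _) (exists_eq_evaluation M) (vonNeumannPredual_component M)

theorem almostInvariantNearInvariant_vonNeumannPredual (G : Type*) [Group G] :
    AlmostInvariantNearInvariant ℂ (vonNeumannPredual M) G := by
  have : CompleteSpace (vonNeumannPredual M) := (isClosed_vonNeumannPredual M).completeSpace_coe
  exact (hasLComponents_vonNeumannPredual M).almostInvariantNearInvariant

end predual

end

/-! ## The dual of a C⋆-algebra as a predual -/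

section

open Set Filter Topology
open scoped InnerProductSpace

section bicommutant

variable {A : Type*} [CStarAlgebra A]
  {K : Type*} [NormedAddCommGroup K] [InnerProductSpace ℂ K] [CompleteSpace K]

/-- The von Neumann algebra generated by a representation. -/
noncomputable def bicommutant (π : A →⋆ₐ[ℂ] (K →L[ℂ] K)) : VonNeumannAlgebra K where
  toStarSubalgebra := StarSubalgebra.centralizer ℂ
    (StarSubalgebra.centralizer ℂ (range π) : Set (K →L[ℂ] K))
  centralizer_centralizer' := by
    change centralizer (centralizer (StarSubalgebra.centralizer ℂ
      (StarSubalgebra.centralizer ℂ (range π) : Set (K →L[ℂ] K)) : Set (K →L[ℂ] K))) =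
      (StarSubalgebra.centralizer ℂ
      (StarSubalgebra.centralizer ℂ (range π) : Set (K →L[ℂ] K)) : Set (K →L[ℂ] K))
    rw [StarSubalgebra.coe_centralizer_centralizer, Set.centralizer_centralizer_centralizer]

theorem rep_mem_bicommutant (π : A →⋆ₐ[ℂ] (K →L[ℂ] K)) (a : A) : π a ∈ bicommutant π := by
  change π a ∈ (StarSubalgebra.centralizer ℂ
      (StarSubalgebra.centralizer ℂ (range π) : Set (K →L[ℂ] K)) : Set (K →L[ℂ] K))
  rw [StarSubalgebra.coe_centralizer_centralizer]
  exact Set.subset_centralizer_centralizer (Or.inl ⟨a, rfl⟩)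

theorem commute_of_mem_bicommutant {π : A →⋆ₐ[ℂ] (K →L[ℂ] K)} {T y : K →L[ℂ] K}
    (hT : T ∈ bicommutant π) (hy : ∀ a, y * π a = π a * y) : y * T = T * y := by
  change T ∈ (StarSubalgebra.centralizer ℂ
      (StarSubalgebra.centralizer ℂ (range π) : Set (K →L[ℂ] K)) : Set (K →L[ℂ] K)) at hT
  rw [StarSubalgebra.coe_centralizer_centralizer] at hT
  refine Set.mem_centralizer_iff.mp hT y (Set.mem_centralizer_iff.mpr ?_)
  rintro m (⟨a, rfl⟩ | ⟨a, ha⟩)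
  · exact (hy a).symm
  · obtain rfl : m = π (star a) := by rw [map_star, ha, star_star]
    exact (hy _).symm

/-- A normal functional vanishing on the image of a representation vanishes on the von Neumann
algebra it generates. -/
theorem sum_inner_eq_zero_of_mem_bicommutant {π : A →⋆ₐ[ℂ] (K →L[ℂ] K)} {ι : Type*} [Fintype ι]
    {θ ζ : ι → K} (h : ∀ a, ∑ i, ⟪θ i, π a (ζ i)⟫_ℂ = 0) {T : K →L[ℂ] K}
    (hT : T ∈ bicommutant π) : ∑ i, ⟪θ i, T (ζ i)⟫_ℂ = 0 := by
  classical
  let ρ := sumRep fun _ : ι ↦ π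
  let σ := sumRep fun _ : ι ↦ StarAlgHom.id ℂ (K →L[ℂ] K)
  let u : lp (fun _ : ι ↦ K) 2 := lpOfFinite θ
  let v : lp (fun _ : ι ↦ K) 2 := lpOfFinite ζ
  let S := cyclicSubspace ρ v
  let E := S.starProjection
  have hE : ∀ a w, E (ρ a w) = ρ a (E w) := starProjection_cyclicSubspace_rep ρ v
  have hσ : ∀ w i, σ T w i = T (w i) := fun _ _ ↦ rfl
  -- Von Neumann's density argument: the matrix entries of `E` commute with `π`, hence with `T`. So
  -- the diagonal copy of `T` preserves the cyclic subspace of `v`.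
  have hent : ∀ i j x, E (lp.single 2 j (T x)) i = T (E (lp.single 2 j x) i) := fun i j x ↦ by
    let y : K →L[ℂ] K := (lp.evalCLM ℂ (fun _ : ι ↦ K) 2 i).comp
      (E.comp (lp.singleContinuousLinearMap ℂ (fun _ : ι ↦ K) 2 j))
    have hy : ∀ a, y * π a = π a * y := fun a ↦ by
      ext x
      change E (lp.single 2 j (π a x)) i = ρ a (E (lp.single 2 j x)) i
      have hs : ρ a (lp.single 2 j x) = lp.single 2 j (π a x) := by
        ext k
        rw [sumRep_apply, lp.single_apply, lp.single_apply]
        obtain rfl | hk := eq_or_ne k j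
        · simp
        · simp [hk]
      rw [← hE, hs]
    exact congr($(commute_of_mem_bicommutant hT hy) x)
  have hsum : ∀ w : lp (fun _ : ι ↦ K) 2, w = ∑ j, lp.single 2 j (w j) := fun w ↦ by
    ext k
    rw [lp.coeFn_sum, Finset.sum_apply]
    simp
  have hET : E (σ T v) = σ T (E v) := by
    ext i
    rw [hσ, hsum (σ T v)]
    conv_rhs => rw [hsum v]
    rw [map_sum, map_sum, lp.coeFn_sum, lp.coeFn_sum, Finset.sum_apply, Finset.sum_apply, map_sum]
    exact Finset.sum_congr rfl fun j _ ↦ hent i j (v j)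
  have hvS : v ∈ S := by
    have := rep_apply_mem_cyclicSubspace ρ v 1
    rwa [map_one] at this
  have hmem : σ T v ∈ S := by
    rw [← S.starProjection_eq_self_iff.mpr hvS, ← hET]
    exact S.starProjection_apply_mem _
  have huS : S ≤ (innerSL ℂ u : lp (fun _ : ι ↦ K) 2 →ₗ[ℂ] ℂ).ker := by
    refine cyclicSubspace_le (isClosed_singleton.preimage (innerSL ℂ u).continuous) fun a ↦ ?_
    have := congr($(coeff_sumRep_of_fintype (fun _ : ι ↦ π) u v) a)
    rw [coeff_apply] at this
    refine this.trans ?_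
    simpa [u, v] using h a
  have h1 : coeff σ u v T = 0 := huS hmem
  rw [coeff_sumRep_of_fintype] at h1
  simpa [u, v, σ] using h1

/-- A representation, as a map to the von Neumann algebra it generates. -/
noncomputable def toBicommutant (π : A →⋆ₐ[ℂ] (K →L[ℂ] K)) :
    A →L[ℂ] (bicommutant π).toStarSubalgebra :=
  LinearMap.mkContinuous
    { toFun := fun a ↦ ⟨π a, rep_mem_bicommutant π a⟩
      map_add' := fun a b ↦ Subtype.ext (map_add π a b)
      map_smul' := fun c a ↦ Subtype.ext (map_smul π c a) } 1 fun a ↦ by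
    rw [one_mul]; exact NonUnitalStarAlgHom.norm_apply_le π a

theorem norm_toBicommutant_le (π : A →⋆ₐ[ℂ] (K →L[ℂ] K)) : ‖toBicommutant π‖ ≤ 1 :=
  LinearMap.mkContinuous_norm_le _ zero_le_one _

/-- If every functional is a coefficient of the representation, in the sense of norms as well, then
restriction does not decrease the norm of normal functionals. -/
theorem norm_le_norm_comp_toBicommutant {π : A →⋆ₐ[ℂ] (K →L[ℂ] K)}
    (hπ : ∀ φ : StrongDual ℂ A, ∃ ξ η : K, ‖ξ‖ ≤ ‖φ‖ ∧ ‖η‖ ≤ 1 ∧ coeff π ξ η = φ)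
    {ω : StrongDual ℂ (bicommutant π).toStarSubalgebra}
    (hω : ω ∈ vonNeumannPredual (bicommutant π)) : ‖ω‖ ≤ ‖ω.comp (toBicommutant π)‖ := by
  have hcl : IsClosed {ω : StrongDual ℂ (bicommutant π).toStarSubalgebra |
      ‖ω‖ ≤ ‖ω.comp (toBicommutant π)‖} :=
    isClosed_le continuous_norm (by fun_prop)
  refine closure_minimal (fun ω hω ↦ ?_) hcl hω
  obtain ⟨n, f, g, rfl⟩ := Submodule.mem_span_set'.mp hω
  choose ξ η hg using fun i ↦ (g i).2
  set ω := ∑ i, f i • (g i : StrongDual ℂ (bicommutant π).toStarSubalgebra)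
  have hω : ∀ T : (bicommutant π).toStarSubalgebra,
      ω T = ∑ i, ⟪ξ i, (T : K →L[ℂ] K) (f i • η i)⟫_ℂ := fun T ↦ by
    simp [ω, hg, vectorFunctional_apply]
  obtain ⟨θ, ζ, hθ, hζ, h⟩ := hπ (ω.comp (toBicommutant π))
  -- Both sides agree on the image of `π`. Their difference is a finite sum of coefficients, so it
  -- vanishes on the bicommutant, and the norm-optimal `θ`, `ζ` bound `‖ω‖`.
  have key : ω = vectorFunctional (bicommutant π) θ ζ := by
    ext T
    have h0 := sum_inner_eq_zero_of_mem_bicommutant (π := π) (θ := Fin.cons θ ξ)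
      (ζ := Fin.cons (-ζ) fun i ↦ f i • η i) (fun a ↦ ?_) T.2
    · rw [Fin.sum_univ_succ] at h0
      simp only [Fin.cons_zero, Fin.cons_succ, map_neg, inner_neg_right] at h0
      rw [hω, vectorFunctional_apply]
      exact (neg_add_eq_zero.mp h0).symm
    · rw [Fin.sum_univ_succ]
      simp only [Fin.cons_zero, Fin.cons_succ, map_neg, inner_neg_right]
      exact neg_add_eq_zero.mpr (congr($h a).trans (hω (toBicommutant π a)))
  calc ‖ω‖ ≤ ‖θ‖ * ‖ζ‖ := by rw [key]; exact norm_vectorFunctional_le _ _ _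
    _ ≤ ‖ω.comp (toBicommutant π)‖ * 1 := by gcongr
    _ = _ := mul_one _

theorem norm_comp_toBicommutant_le (π : A →⋆ₐ[ℂ] (K →L[ℂ] K))
    (ω : StrongDual ℂ (bicommutant π).toStarSubalgebra) : ‖ω.comp (toBicommutant π)‖ ≤ ‖ω‖ :=
  calc _ ≤ ‖ω‖ * ‖toBicommutant π‖ := ContinuousLinearMap.opNorm_comp_le _ _
    _ ≤ ‖ω‖ * 1 := by gcongr; exact norm_toBicommutant_le π
    _ = _ := mul_one _

/-- The restriction of functionals along `toBicommutant`. -/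
noncomputable def restrictBicommutant (π : A →⋆ₐ[ℂ] (K →L[ℂ] K)) :
    StrongDual ℂ (bicommutant π).toStarSubalgebra →ₗ[ℂ] StrongDual ℂ A where
  toFun ω := ω.comp (toBicommutant π)
  map_add' _ _ := rfl
  map_smul' _ _ := rfl

theorem AlmostInvariantNearInvariant.of_submodule {D W G : Type*} [NormedAddCommGroup D]
    [NormedSpace ℂ D] [NormedAddCommGroup W] [NormedSpace ℂ W] [Group G] {F : Submodule ℂ D}
    (h : AlmostInvariantNearInvariant ℂ F G) (r : D →ₗ[ℂ] W) (hn : ∀ ω ∈ F, ‖r ω‖ = ‖ω‖)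
    (hs : ∀ w, ∃ ω ∈ F, r ω = w) : AlmostInvariantNearInvariant ℂ W G := by
  let e : F →ₗᵢ[ℂ] W := ⟨r ∘ₗ F.subtype, fun ω ↦ hn ω.1 ω.2⟩
  refine .of_linearIsometryEquiv (LinearIsometryEquiv.ofSurjective e fun w ↦ ?_).symm h
  obtain ⟨ω, hω, rfl⟩ := hs w
  exact ⟨⟨ω, hω⟩, rfl⟩

theorem almostInvariantNearInvariant_strongDual_of_coeff (G : Type*) [Group G]
    {π : A →⋆ₐ[ℂ] (K →L[ℂ] K)}
    (hπ : ∀ φ : StrongDual ℂ A, ∃ ξ η : K, ‖ξ‖ ≤ ‖φ‖ ∧ ‖η‖ ≤ 1 ∧ coeff π ξ η = φ) :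
    AlmostInvariantNearInvariant ℂ (StrongDual ℂ A) G := by
  have h1 : ∀ ω ∈ vonNeumannPredual (bicommutant π), ‖restrictBicommutant π ω‖ = ‖ω‖ :=
    fun ω hω ↦ le_antisymm (norm_comp_toBicommutant_le π ω) (norm_le_norm_comp_toBicommutant hπ hω)
  have h2 : ∀ φ, ∃ ω ∈ vonNeumannPredual (bicommutant π), restrictBicommutant π ω = φ := fun φ ↦ by
    obtain ⟨ξ, η, -, -, h⟩ := hπ φ
    exact ⟨vectorFunctional (bicommutant π) ξ η, vectorFunctional_mem (bicommutant π) ξ η, h⟩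
  exact (almostInvariantNearInvariant_vonNeumannPredual (bicommutant π) G).of_submodule
    (restrictBicommutant π) h1 h2

/-- The dual of a C⋆-algebra is the predual of its enveloping von Neumann algebra, whence almost
invariant functionals on a C⋆-algebra are near invariant ones. -/
theorem almostInvariantNearInvariant_strongDual (A : Type*) [CStarAlgebra A] (G : Type*) [Group G] :
    AlmostInvariantNearInvariant ℂ (StrongDual ℂ A) G := by
  let := CStarAlgebra.spectralOrder A
  have := CStarAlgebra.spectralOrderedRing A
  have hπ := exists_eq_univRep_coeff (A := A)
  generalize univRep A = π at hπ
  exact almostInvariantNearInvariant_strongDual_of_coeff G hπ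

end bicommutant

end

theorem theorem1p7 (G : Type*) [Group G] :
    (∀ (𝕜 W : Type*) [RCLike 𝕜] [NormedAddCommGroup W] [NormedSpace 𝕜 W] [CompleteSpace W],
      IsLEmbedded 𝕜 W → AlmostInvariantNearInvariant 𝕜 W G) ∧
    (∀ (𝕜 V : Type*) [RCLike 𝕜] [NormedAddCommGroup V] [NormedSpace 𝕜 V] [CompleteSpace V],
      IsLEmbedded 𝕜 (StrongDual 𝕜 V) → DualAlmostInvariantNearInvariant 𝕜 V G) ∧
    (∀ (X : Type*) [TopologicalSpace X] [CompactSpace X] [T2Space X],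
      AlmostInvariantNearInvariant ℂ (StrongDual ℂ C(X, ℂ)) G ∧
      DualAlmostInvariantNearInvariant ℂ C(X, ℂ) G) ∧
    (∀ (H : Type*) [NormedAddCommGroup H] [InnerProductSpace ℂ H] [CompleteSpace H]
      (M : VonNeumannAlgebra H),
      AlmostInvariantNearInvariant ℂ (vonNeumannPredual M) G) := by
  refine ⟨fun 𝕜 W _ _ _ _ h ↦ h.hasLComponents.almostInvariantNearInvariant,
    fun 𝕜 V _ _ _ _ h ↦ h.hasLComponents.almostInvariantNearInvariant.dual,
    fun X _ _ _ ↦ ?_, fun H _ _ _ M ↦ almostInvariantNearInvariant_vonNeumannPredual M G⟩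
  have h := almostInvariantNearInvariant_strongDual C(X, ℂ) G
  exact ⟨h, h.dual⟩
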